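/- Let $N\ge 0$ and let $H_N$ be the rational Cherednik algebra of type $A$: the unital associative $\mathbb C$-algebra with generators $x_i,y_i,s_{jk}$ ($i,j,k\in\{1,\dots,N\}$, $j\ne k$) and relations $$s_{ij}=s_{ji},\quad s_{ij}^2=1,\quad s_{ij}s_{jk}=s_{ik}s_{ij},\quad s_{ij}s_{kl}=s_{kl}s_{ij},\quad [x_i,x_j]=[y_i,y_j]=0,$$ $$s_{ij}x_i=x_js_{ij},\quad s_{ij}y_i=y_js_{ij},\quad [s_{ij},x_k]=[s_{ij},y_k]=0,\quad [x_i,y_j]=s_{ij},\quad [x_i,y_i]=-\sum_{a\ne i}s_{ia},$$ where in each relation different index letters denote distinct indices. A permutation $\sigma\in S_N$ is regarded as an element of $H_N$ through the homomorphism from $S_N$ to the group of units of $H_N$ that sends the transposition $(i\,j)$ to $s_{ij}$. Let $:\ :$ denote the normal ordering map, i.e. the linear map from $\mathbb C[x_1,\dots,x_N]\otimes\mathbb C[y_1,\dots,y_N]$ to $H_N$ given by $q(x)\otimes p(y)\mapsto q(x)p(y)$, applied coefficientwise to polynomials in the central variables $u,v$. Let $$\mathcal P^{\mathcal Z}=(-1)^N\sum_{\sigma\in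 S_N}\ :\!\prod_{i,\ \sigma(i)=i}\bigl(1-(v-x_i)(u-y_i)\bigr)\!:\ (-1)^\sigma\,\sigma\;=\;\sum_{i,j=0}^N c_{ij}\,v^{N-i}u^{N-j},\qquad c_{ij}\in H_N,$$ where $(-1)^\sigma$ is the sign of $\sigma$. Then the elements $c_{ij}$, $i,j=0,\dots,N$, are central in $H_N$, and they generate the center $\mathcal Z_N$ of $H_N$ as a unital $\mathbb C$-algebra. -/

import Mathlib

namespace CherednikTypeA

open Equiv Polynomial

/-! ### The symmetric group from its transpositions -/

theorem decomposeFin_symm_eq {n : ℕ} (p : Fin (n + 1)) (e : Perm (Fin n)) :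
    Perm.decomposeFin.symm (p, e) = swap 0 p * Perm.decomposeFin.symm (0, e) := by
  ext x
  refine Fin.cases ?_ (fun y => ?_) x <;> simp

theorem swap_succ_mul {n : ℕ} (i j : Fin n) (e : Perm (Fin n)) :
    swap i.succ j.succ * Perm.decomposeFin.symm (0, e) =
      Perm.decomposeFin.symm (0, swap i j * e) := by
  ext x
  refine Fin.cases ?_ (fun y => ?_) x
  · simp [swap_apply_of_ne_of_ne (Fin.succ_ne_zero i).symm (Fin.succ_ne_zero j).symm]
  · simp only [Perm.mul_apply, Perm.decomposeFin_symm_apply_succ, swap_self, refl_apply]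
    rw [(Fin.succ_injective n).swap_apply]

/-- Elements `s i j` of a monoid that satisfy the defining relations of the transpositions extend to
a homomorphism from the symmetric group. -/
theorem exists_permHom {M : Type*} [Monoid M] : ∀ {n : ℕ} (s : Fin n → Fin n → M)
    (_ : ∀ i, s i i = 1)
    (_ : ∀ i j, i ≠ j → s i j = s j i)
    (_ : ∀ i j, i ≠ j → s i j * s i j = 1)
    (_ : ∀ i j k, i ≠ j → j ≠ k → i ≠ k → s i j * s j k = s i k * s i j)
    (_ : ∀ i j k l, i ≠ j → i ≠ k → i ≠ l → j ≠ k → j ≠ l → k ≠ l →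
      s i j * s k l = s k l * s i j),
    ∃ ρ : Perm (Fin n) →* M, ∀ i j, i ≠ j → ρ (swap i j) = s i j := by
  intro n
  induction n with
  | zero => intro s _ _ _ _ _; exact ⟨1, fun i => i.elim0⟩
  | succ n ih =>
    intro s h1 hsymm hsq hbr hcomm
    obtain ⟨ρ, hρ⟩ := ih (fun i j => s i.succ j.succ) (fun i => h1 _)
      (fun i j h => hsymm _ _ (by simpa using h))
      (fun i j h => hsq _ _ (by simpa using h))
      (fun i j k h h' h'' => hbr _ _ _ (by simpa using h) (by simpa using h') (by simpa using h''))
      (fun i j k l a b c d e f => hcomm _ _ _ _ (by simpa using a) (by simpa using b)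
        (by simpa using c) (by simpa using d) (by simpa using e) (by simpa using f))
    let f : Perm (Fin (n + 1)) → M := fun σ =>
      s 0 (Perm.decomposeFin σ).1 * ρ (Perm.decomposeFin σ).2
    have hf : ∀ p e, f (Perm.decomposeFin.symm (p, e)) = s 0 p * ρ e := by
      intro p e; simp [f]
    have hf' : ∀ p e, f (swap 0 p * Perm.decomposeFin.symm (0, e)) = s 0 p * ρ e := by
      intro p e; rw [← decomposeFin_symm_eq, hf]
    -- left multiplication by a transposition away from `0`
    have key1 : ∀ (i j : Fin n), i ≠ j → ∀ σ, f (swap i.succ j.succ * σ) =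
        s i.succ j.succ * f σ := by
      intro i j hij σ
      obtain ⟨⟨p, e⟩, rfl⟩ := Perm.decomposeFin.symm.surjective σ
      rw [hf, decomposeFin_symm_eq, ← mul_assoc, mul_swap_eq_swap_mul, mul_assoc, swap_succ_mul,
        swap_apply_of_ne_of_ne (Fin.succ_ne_zero i).symm (Fin.succ_ne_zero j).symm, hf', map_mul,
        hρ i j hij, ← mul_assoc, ← mul_assoc]
      congr 1
      have hij' : i.succ ≠ j.succ := by simpa using hij
      have h0i := (Fin.succ_ne_zero i).symm
      have h0j := (Fin.succ_ne_zero j).symm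
      by_cases hp0 : p = 0
      · subst hp0
        rw [swap_apply_of_ne_of_ne h0i h0j, h1, one_mul, mul_one]
      by_cases hpi : p = i.succ
      · subst hpi
        rw [swap_apply_left, hsymm _ _ hij', hsymm _ _ h0i, hbr _ _ _ hij'.symm h0i.symm h0j.symm,
          hsymm _ _ h0j]
      by_cases hpj : p = j.succ
      · subst hpj
        rw [swap_apply_right, hsymm _ _ h0j, hbr _ _ _ hij' h0j.symm h0i.symm,
          hsymm _ _ h0i]
      · rw [swap_apply_of_ne_of_ne hpi hpj]
        exact hcomm _ _ _ _ (Ne.symm hp0) h0i h0j hpi hpj hij'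
    have key0 : ∀ j : Fin (n + 1), j ≠ 0 → ∀ σ, f (swap 0 j * σ) = s 0 j * f σ := by
      intro j hj σ
      obtain ⟨⟨p, e⟩, rfl⟩ := Perm.decomposeFin.symm.surjective σ
      by_cases hp0 : p = 0
      · subst hp0
        rw [hf', hf, h1, one_mul]
      by_cases hpj : p = j
      · subst hpj
        rw [decomposeFin_symm_eq, swap_mul_self_mul, hf, hf', ← mul_assoc, hsq _ _ (Ne.symm hp0),
          h1]
      · obtain ⟨p, rfl⟩ := Fin.exists_succ_eq.2 hp0
        obtain ⟨j, rfl⟩ := Fin.exists_succ_eq.2 hj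
        have hne : p ≠ j := fun h => hpj (by rw [h])
        have : swap 0 j.succ * (swap 0 p.succ * Perm.decomposeFin.symm (0, e)) =
            swap 0 p.succ * Perm.decomposeFin.symm (0, swap j p * e) := by
          rw [← swap_succ_mul, ← mul_assoc, ← mul_assoc]
          congr 1
          rw [mul_swap_eq_swap_mul (swap 0 p.succ) j.succ p.succ,
            swap_apply_of_ne_of_ne (Fin.succ_ne_zero j) (Ne.symm hpj), swap_apply_right,
            swap_comm j.succ 0]
        rw [decomposeFin_symm_eq, this, hf', hf', map_mul, hρ _ _ hne.symm, ← mul_assoc,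
          ← mul_assoc]
        congr 1
        rw [hsymm _ _ (by simpa using hne.symm : j.succ ≠ p.succ)]
        rw [hbr 0 p.succ j.succ (Ne.symm hp0) (by simpa using hne) hj.symm]
    have key : ∀ i j : Fin (n + 1), i ≠ j → ∀ σ, f (swap i j * σ) = s i j * f σ := by
      intro i j hij σ
      by_cases hi : i = 0
      · subst hi; exact key0 j hij.symm σ
      by_cases hj : j = 0
      · subst hj; rw [swap_comm, hsymm _ _ hij]; exact key0 i hi σ
      · obtain ⟨i, rfl⟩ := Fin.exists_succ_eq.2 hi
        obtain ⟨j, rfl⟩ := Fin.exists_succ_eq.2 hj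
        exact key1 i j (fun h => hij (by rw [h])) σ
    have hone : f 1 = 1 := by
      have h := hf 0 1
      rw [h1, map_one, mul_one] at h
      rw [← h]
      congr 1
      ext x
      refine Fin.cases ?_ (fun y => ?_) x <;> simp
    have hmul : ∀ σ τ, f (σ * τ) = f σ * f τ := by
      intro σ τ
      induction σ using Perm.swap_induction_on with
      | one => rw [hone, one_mul, one_mul]
      | swap_mul g x y hxy ihg => rw [mul_assoc, key x y hxy, ihg, key x y hxy g, mul_assoc (s x y)]
    refine ⟨⟨⟨f, hone⟩, hmul⟩, fun i j hij => ?_⟩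
    have h := key i j hij 1
    rw [hone, mul_one, mul_one] at h
    exact h

/-! ### The rational Cherednik algebra -/

/-- The generators `x_i`, `y_i` and `s_{jk}` with `j ≠ k`. -/
inductive Gen (N : ℕ) : Type
  | x (i : Fin N) : Gen N
  | y (i : Fin N) : Gen N
  | s (j k : Fin N) (h : j ≠ k) : Gen N

/-- The generators inside the free algebra. -/
abbrev fx {N : ℕ} (i : Fin N) : FreeAlgebra ℂ (Gen N) := FreeAlgebra.ι ℂ (Gen.x i)

/-- See `fx`. -/
abbrev fy {N : ℕ} (i : Fin N) : FreeAlgebra ℂ (Gen N) := FreeAlgebra.ι ℂ (Gen.y i)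

/-- See `fx`. -/
abbrev fs {N : ℕ} (j k : Fin N) (h : j ≠ k) : FreeAlgebra ℂ (Gen N) :=
  FreeAlgebra.ι ℂ (Gen.s j k h)

/-- The defining relations of the rational Cherednik algebra of type `A`; in each of them different
index letters stand for distinct indices. -/
inductive Rel (N : ℕ) : FreeAlgebra ℂ (Gen N) → FreeAlgebra ℂ (Gen N) → Prop
  | s_symm (i j : Fin N) (h : i ≠ j) : Rel N (fs i j h) (fs j i h.symm)
  | s_sq (i j : Fin N) (h : i ≠ j) : Rel N (fs i j h * fs i j h) 1
  | s_mul_s (i j k : Fin N) (hij : i ≠ j) (hjk : j ≠ k) (hik : i ≠ k) :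
      Rel N (fs i j hij * fs j k hjk) (fs i k hik * fs i j hij)
  | s_comm (i j k l : Fin N) (hij : i ≠ j) (hik : i ≠ k) (hil : i ≠ l) (hjk : j ≠ k) (hjl : j ≠ l)
      (hkl : k ≠ l) : Rel N (fs i j hij * fs k l hkl) (fs k l hkl * fs i j hij)
  | x_comm (i j : Fin N) (h : i ≠ j) : Rel N (fx i * fx j) (fx j * fx i)
  | y_comm (i j : Fin N) (h : i ≠ j) : Rel N (fy i * fy j) (fy j * fy i)
  | s_mul_x (i j : Fin N) (h : i ≠ j) : Rel N (fs i j h * fx i) (fx j * fs i j h)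
  | s_mul_y (i j : Fin N) (h : i ≠ j) : Rel N (fs i j h * fy i) (fy j * fs i j h)
  | s_comm_x (i j k : Fin N) (hij : i ≠ j) (hik : i ≠ k) (hjk : j ≠ k) :
      Rel N (fs i j hij * fx k) (fx k * fs i j hij)
  | s_comm_y (i j k : Fin N) (hij : i ≠ j) (hik : i ≠ k) (hjk : j ≠ k) :
      Rel N (fs i j hij * fy k) (fy k * fs i j hij)
  | x_y (i j : Fin N) (h : i ≠ j) : Rel N (fx i * fy j - fy j * fx i) (fs i j h)
  | x_y_self (i : Fin N) :
      Rel N (fx i * fy i - fy i * fx i) (-∑ a : {a : Fin N // a ≠ i}, fs i a.1 a.2.symm)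

/-- The rational Cherednik algebra `H_N` associated with the symmetric group `S_N`. -/
def H (N : ℕ) : Type := RingQuot (Rel N)

noncomputable instance (N : ℕ) : Ring (H N) := RingQuot.instRing (Rel N)

noncomputable instance (N : ℕ) : Algebra ℂ (H N) := RingQuot.instAlgebra (Rel N)

/-- The quotient map from the free algebra onto `H_N`. -/
noncomputable def mk (N : ℕ) : FreeAlgebra ℂ (Gen N) →ₐ[ℂ] H N := RingQuot.mkAlgHom ℂ (Rel N)

theorem mk_rel {N : ℕ} {a b : FreeAlgebra ℂ (Gen N)} (h : Rel N a b) : mk N a = mk N b :=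
  RingQuot.mkAlgHom_rel ℂ h

/-- The generator `x_i` of `H_N`. -/
noncomputable def hx {N : ℕ} (i : Fin N) : H N := mk N (fx i)

/-- The generator `y_i` of `H_N`. -/
noncomputable def hy {N : ℕ} (i : Fin N) : H N := mk N (fy i)

/-- The generator `s_{jk}` of `H_N`. -/
noncomputable def hs {N : ℕ} (j k : Fin N) (h : j ≠ k) : H N := mk N (fs j k h)

theorem exists_permH (N : ℕ) :
    ∃ ρ : Perm (Fin N) →* H N, ∀ (i j : Fin N) (h : i ≠ j), ρ (swap i j) = hs i j h := by
  obtain ⟨ρ, hρ⟩ := exists_permHom (M := H N) (n := N)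
    (fun i j => if h : i ≠ j then hs i j h else 1) (by simp)
    (by
      intro i j h
      simp only [dif_pos h, dif_pos h.symm]
      exact mk_rel (Rel.s_symm i j h))
    (by
      intro i j h
      simp only [dif_pos h, hs]
      rw [← map_mul, mk_rel (Rel.s_sq i j h), map_one])
    (by
      intro i j k h h' h''
      simp only [dif_pos h, dif_pos h', dif_pos h'', hs]
      rw [← map_mul, mk_rel (Rel.s_mul_s i j k h h' h''), map_mul])
    (by
      intro i j k l a b c d e f
      simp only [dif_pos a, dif_pos f, hs]
      rw [← map_mul, mk_rel (Rel.s_comm i j k l a b c d e f), map_mul])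
  exact ⟨ρ, fun i j h => by rw [hρ i j h, dif_pos h]⟩

/-- The homomorphism `S_N → H_N` that sends the transposition of `i` and `j` to `s_{ij}`. -/
noncomputable def permH (N : ℕ) : Perm (Fin N) →* H N := Classical.choose (exists_permH N)

theorem permH_swap {N : ℕ} (i j : Fin N) (h : i ≠ j) : permH N (swap i j) = hs i j h :=
  Classical.choose_spec (exists_permH N) i j h

/-- `permH` is the only homomorphism with this property. -/
theorem permH_unique {N : ℕ} (ρ : Perm (Fin N) →* H N)
    (hρ : ∀ (i j : Fin N) (h : i ≠ j), ρ (swap i j) = hs i j h) : ρ = permH N := by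
  ext σ
  induction σ using Perm.swap_induction_on with
  | one => simp
  | swap_mul g i j h ih => rw [map_mul, map_mul, ih, hρ i j h, permH_swap i j h]

/-! ### Normal ordering and the universal central polynomial -/

/-- The algebra `ℂ[x] ⊗ ℂ[y]` of polynomials in the commuting variables `x_i` (`Sum.inl i`) and
`y_i` (`Sum.inr i`). -/
abbrev XY (N : ℕ) : Type := MvPolynomial (Fin N ⊕ Fin N) ℂ

/-- The normal ordering map on `ℂ[x] ⊗ ℂ[y]`: the linear map `q(x) p(y) ↦ q(x) p(y) ∈ H_N`, which
writes the `x_i` to the left of the `y_i`. -/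
noncomputable def normalOrder (N : ℕ) : XY N →ₗ[ℂ] H N :=
  (MvPolynomial.basisMonomials (Fin N ⊕ Fin N) ℂ).constr ℂ fun m =>
    (List.ofFn fun i : Fin N => hx i ^ m (Sum.inl i)).prod *
      (List.ofFn fun i : Fin N => hy i ^ m (Sum.inr i)).prod

/-- Normal ordering of the coefficients of a polynomial in `u` and `v`. Polynomials in two variables
are written as `R[u][v]`, so `v` is `X` and `u` is `C X`. -/
noncomputable def normalOrderPoly (N : ℕ) (p : (XY N)[X][X]) : (H N)[X][X] :=
  p.sum fun a q => monomial a (q.sum fun b r => monomial b (normalOrder N r))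

/-- The factor `1 - (v - x_i)(u - y_i)`. -/
noncomputable def centralFactor {N : ℕ} (i : Fin N) : (XY N)[X][X] :=
  1 - (X - C (C (MvPolynomial.X (Sum.inl i)))) * (C X - C (C (MvPolynomial.X (Sum.inr i))))

/-- The universal central polynomial
`(-1)^N ∑_σ :∏_{σ(i) = i} (1 - (v - x_i)(u - y_i)): (-1)^σ σ`. -/
noncomputable def centralPoly (N : ℕ) : (H N)[X][X] :=
  (-1) ^ N * ∑ σ : Perm (Fin N),
    normalOrderPoly N (∏ i : Fin N with σ i = i, centralFactor i) *
      (((Perm.sign σ : ℤ) : (H N)[X][X]) * C (C (permH N σ)))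

/-- `c_{ij}`, the coefficient of `v^{N-i} u^{N-j}` in the universal central polynomial,
for `i, j = 0, …, N`. -/
noncomputable def c {N : ℕ} (i j : Fin (N + 1)) : H N :=
  ((centralPoly N).coeff (N - (i : ℕ))).coeff (N - (j : ℕ))

end CherednikTypeA

/-!
The proof compares `H_N` with a skew group algebra by means of Dunkl operators.

*Centrality.* Expanding the product over the fixed points of `σ` turns the universal central
polynomial into `(-1)^N ∑_J (-1)^{|J|} x_J y_J A_J`, where `J` runs over the subsets of the index set,
`x_J` and `y_J` are the products of the `v - x_j` and of the `u - y_j` with `j ∈ J`, and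
`A_J = ∑_σ (-1)^σ σ` over the permutations that fix `J` pointwise (`centralPoly_eq`). As `v - x_i` and
`u - y_i` satisfy the same relations as `x_i` and `y_i`, the sum can be studied in any ring with such
elements (`CherednikSystem.theta`). It visibly commutes with permutations. It commutes with `x_k`
(`CherednikSystem.theta_commute_x`) because the commutator of `x_k` with a product of `y_j` removes one
factor and inserts a transposition, and after sorting by the remaining set and the resulting
permutation everything cancels in pairs. Commutation with the `y_k` is then automatic, as explained
next.

*The Dunkl representation.* Let `K = ℂ(x, p)`. The elements `x_i`, `σ` and
`t p_i - ∑_{a ≠ i} (x_i - x_a)⁻¹ s_{ia}` of `(K ⋊ S_N)[t]` define a homomorphism `dunkl` from `H_N`.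
The products `q(x) p(y) σ` span `H_N`, and the top coefficient in `t` of the image of a combination of
these is obtained by writing `p_i` for `y_i`. So `dunkl` is injective (`dunkl_injective`). An element
of the skew group algebra that commutes with all `x_k` lies in `K`, and invariant elements of `K`
commute with the Dunkl operators. Hence an element of `H_N` is central as soon as it commutes with the
`x_k` and with permutations (`mem_center_of_commute_hx_permH`), and the symbol of a central element,
its top coefficient in `t`, is an invariant polynomial in `x` and `p`
(`exists_symbol_of_mem_center`).

*Generation.* By induction on the degree in `t` it suffices that every invariant polynomial that is
homogeneous in `p` is the symbol of an element of the algebra generated by the `c_{ij}`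
(`lifts_of_invariant`). The coefficients of `u^N` and of `v^N` are, up to sign, the elementary
symmetric functions of the `x_i` and of the `y_i`. After subtraction of their products, the other
coefficients have, up to sign, the symbols `∑_i e_a(x without x_i) e_b(p without p_i)`
(`lifts_sum_coeff_mul_coeff`), as smaller sets `J` contribute in lower degree. The recursion
`x_i e_a(x without x_i) = e_{a+1}(x) - e_{a+1}(x without x_i)`, and the same one for `p`, give all
power sums `∑_i x_i^a p_i^b` (`lifts_powerSum`), and a polarized form of Newton's recursion gives all
symmetrized monomials (`lifts_injSum`).
-/

namespace CherednikTypeA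

open Equiv Polynomial Finset

/-! ### The alternating sum over subsets and its commutation with the `x_k` -/

/-- Elements `x_i`, `y_i` of a ring together with a homomorphism from the symmetric group to it
that satisfy the relations of the rational Cherednik algebra. -/
structure CherednikSystem (N : ℕ) (Q : Type*) [Ring Q] where
  /-- The images of the permutations. -/
  perm : Perm (Fin N) →* Q
  /-- The elements `x_i`. -/
  x : Fin N → Q
  /-- The elements `y_i`. -/
  y : Fin N → Q
  x_comm : ∀ i j, Commute (x i) (x j)
  y_comm : ∀ i j, Commute (y i) (y j)
  perm_mul_x : ∀ g i, perm g * x i = x (g i) * perm g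
  perm_mul_y : ∀ g i, perm g * y i = y (g i) * perm g
  x_mul_y : ∀ i j, i ≠ j → x i * y j = y j * x i + perm (swap i j)
  x_mul_y_self : ∀ i, x i * y i = y i * x i - ∑ a ∈ univ.erase i, perm (swap i a)

namespace CherednikSystem

variable {N : ℕ} {Q : Type*} [Ring Q] (D : CherednikSystem N Q)

/-- The product of the `x_j` over a finite set of indices. -/
def xs (J : Finset (Fin N)) : Q := J.noncommProd D.x fun _ _ _ _ _ => D.x_comm _ _

/-- The product of the `y_j` over a finite set of indices. -/
def ys (J : Finset (Fin N)) : Q := J.noncommProd D.y fun _ _ _ _ _ => D.y_comm _ _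

@[simp] theorem xs_empty : D.xs ∅ = 1 := noncommProd_empty _ _

@[simp] theorem ys_empty : D.ys ∅ = 1 := noncommProd_empty _ _

theorem xs_insert {J : Finset (Fin N)} {a : Fin N} (h : a ∉ J) :
    D.xs (insert a J) = D.x a * D.xs J :=
  noncommProd_insert_of_notMem _ _ _ _ h

theorem ys_insert {J : Finset (Fin N)} {a : Fin N} (h : a ∉ J) :
    D.ys (insert a J) = D.y a * D.ys J :=
  noncommProd_insert_of_notMem _ _ _ _ h

theorem x_commute_xs (k : Fin N) (J : Finset (Fin N)) : Commute (D.x k) (D.xs J) :=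
  noncommProd_commute _ _ _ _ fun _ _ => D.x_comm _ _

theorem perm_mul_xs (g : Perm (Fin N)) (J : Finset (Fin N)) :
    D.perm g * D.xs J = D.xs (J.image g) * D.perm g := by
  induction J using Finset.induction_on with
  | empty => simp
  | insert a J ha ih =>
    have : g a ∉ J.image g := by simpa using ha
    rw [xs_insert _ ha, image_insert, xs_insert _ this, ← mul_assoc, D.perm_mul_x, mul_assoc, ih,
      mul_assoc]

theorem perm_mul_ys (g : Perm (Fin N)) (J : Finset (Fin N)) :
    D.perm g * D.ys J = D.ys (J.image g) * D.perm g := by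
  induction J using Finset.induction_on with
  | empty => simp
  | insert a J ha ih =>
    have : g a ∉ J.image g := by simpa using ha
    rw [ys_insert _ ha, image_insert, ys_insert _ this, ← mul_assoc, D.perm_mul_y, mul_assoc, ih,
      mul_assoc]

theorem image_swap_of_notMem {α : Type*} [DecidableEq α] {J : Finset α} {a b : α} (ha : a ∉ J)
    (hb : b ∉ J) : J.image (swap a b) = J := by
  ext i
  rw [mem_image]
  constructor
  · rintro ⟨j, hj, rfl⟩
    rwa [swap_apply_of_ne_of_ne (by rintro rfl; exact ha hj) (by rintro rfl; exact hb hj)]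
  · intro hi
    exact ⟨i, hi, swap_apply_of_ne_of_ne (by rintro rfl; exact ha hi) (by rintro rfl; exact hb hi)⟩

theorem image_swap_of_mem {α : Type*} [DecidableEq α] {J : Finset α} {a b : α} (ha : a ∉ J)
    (hb : b ∈ J) : J.image (swap a b) = insert a (J.erase b) := by
  conv_lhs => rw [← insert_erase hb]
  rw [image_insert, swap_apply_right,
    image_swap_of_notMem (fun h => ha (mem_of_mem_erase h)) (notMem_erase b J)]

/-- Moving `x_k` to the right of a product of `y_j` with `j ≠ k`. -/
theorem x_mul_ys {k : Fin N} {J : Finset (Fin N)} (hk : k ∉ J) :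
    D.x k * D.ys J = D.ys J * D.x k + ∑ j ∈ J, D.ys (J.erase j) * D.perm (swap k j) := by
  induction J using Finset.induction_on with
  | empty => simp
  | insert a J ha ih =>
    rw [mem_insert, not_or] at hk
    have h1 : ∀ j ∈ J, D.ys ((insert a J).erase j) * D.perm (swap k j) =
        D.y a * (D.ys (J.erase j) * D.perm (swap k j)) := by
      intro j hj
      rw [erase_insert_of_ne (by rintro rfl; exact ha hj), ys_insert, mul_assoc]
      exact fun h => ha (mem_of_mem_erase h)
    rw [ys_insert _ ha, sum_insert ha, erase_insert ha, ← mul_assoc, D.x_mul_y _ _ hk.1, add_mul,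
      mul_assoc, ih hk.2, D.perm_mul_ys, image_swap_of_notMem hk.2 ha, mul_add, mul_sum, mul_assoc]
    rw [sum_congr rfl h1]
    abel

/-- Moving `x_k` to the right of a product of `y_j` that contains `y_k`. -/
theorem x_mul_ys_insert {k : Fin N} {M : Finset (Fin N)} (hk : k ∉ M) :
    D.x k * D.ys (insert k M) = D.ys (insert k M) * D.x k -
      ∑ a ∈ (insert k M)ᶜ, D.ys M * D.perm (swap k a) := by
  have hs : univ.erase k = M ∪ (insert k M)ᶜ := by
    ext i
    simp only [mem_erase, mem_univ, and_true, mem_union, mem_compl, mem_insert, not_or]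
    by_cases h : i = k
    · subst h; simp [hk]
    · simp [h, em]
  have hd : Disjoint M (insert k M)ᶜ :=
    disjoint_compl_right.mono_left (subset_insert _ _)
  rw [ys_insert _ hk, ← mul_assoc, D.x_mul_y_self, sub_mul, mul_assoc, D.x_mul_ys hk, mul_add,
    hs, sum_union hd, add_mul, sum_mul, sum_mul, mul_sum, mul_assoc]
  have h1 : ∀ i ∈ M, D.perm (swap k i) * D.ys M =
      D.y k * (D.ys (M.erase i) * D.perm (swap k i)) := by
    intro i hi
    rw [D.perm_mul_ys, image_swap_of_mem hk hi, ys_insert, mul_assoc]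
    exact fun h => hk (mem_of_mem_erase h)
  have h2 : ∀ i ∈ (insert k M)ᶜ, D.perm (swap k i) * D.ys M = D.ys M * D.perm (swap k i) := by
    intro i hi
    rw [D.perm_mul_ys, image_swap_of_notMem hk]
    simp only [mem_compl, mem_insert, not_or] at hi
    exact hi.2
  rw [sum_congr rfl h1, sum_congr rfl h2]
  abel

/-- The permutations that fix every element of `J`. -/
def fix (J : Finset (Fin N)) : Finset (Perm (Fin N)) := {σ | ∀ j ∈ J, σ j = j}

theorem mem_fix {J : Finset (Fin N)} {σ : Perm (Fin N)} : σ ∈ fix J ↔ ∀ j ∈ J, σ j = j := by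
  simp [fix]

/-- The sign `(-1)^{|J|} (-1)^σ`. -/
def eps (J : Finset (Fin N)) (σ : Perm (Fin N)) : ℤ := (-1) ^ #J * Perm.sign σ

/-- The element `∑_J (-1)^{|J|} x_J y_J ∑_σ (-1)^σ σ`, where `σ` runs over the permutations that
fix `J` pointwise. -/
def theta : Q := ∑ J, ∑ σ ∈ fix J, eps J σ • (D.xs J * D.ys J * D.perm σ)

theorem eps_insert_swap_mul {M : Finset (Fin N)} {k l : Fin N} (hkl : k ≠ l)
    (b : Fin N) (hb : b ∉ M) (σ : Perm (Fin N)) : eps M (swap k l * σ) = eps (insert b M) σ := by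
  simp [eps, card_insert_of_notMem hb, Perm.sign_swap hkl, pow_succ]

theorem eps_insert_mul_swap {M : Finset (Fin N)} {k l : Fin N} (hkl : k ≠ l)
    (b : Fin N) (hb : b ∉ M) (σ : Perm (Fin N)) : eps M (σ * swap k l) = eps (insert b M) σ := by
  simp [eps, card_insert_of_notMem hb, Perm.sign_swap hkl, pow_succ]

/-- Pairs of a set and one of its elements correspond to pairs of a set and an element outside. -/
theorem sum_mem_eq_sum_notMem {A : Type*} [AddCommMonoid A] {α : Type*} [DecidableEq α] [Fintype α]
    (f : Finset α → α → A) :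
    ∑ J, ∑ l ∈ J, f (J.erase l) l = ∑ M, ∑ l ∈ Mᶜ, f M l := by
  rw [sum_sigma', sum_sigma']
  refine sum_bij' (fun p _ => ⟨p.1.erase p.2, p.2⟩) (fun p _ => ⟨insert p.2 p.1, p.2⟩) ?_ ?_ ?_ ?_ ?_
  · rintro ⟨J, l⟩ _; simp
  · rintro ⟨J, l⟩ _; simp
  · rintro ⟨J, l⟩ h
    simp only [mem_sigma, mem_univ, true_and] at h
    simp [insert_erase h]
  · rintro ⟨J, l⟩ h
    simp only [mem_sigma, mem_univ, true_and, mem_compl] at h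
    simp [erase_insert h]
  · rintro ⟨J, l⟩ _; rfl

/-- Right multiplication by `(k l)` carries the permutations that fix `M ∪ {l}` to those that fix `M`
and send `k` to `l`. -/
theorem sum_fix_insert_mul_swap {A : Type*} [AddCommMonoid A] {M : Finset (Fin N)} {k l : Fin N}
    (hk : k ∉ M) (hl : l ∉ M) (F : Perm (Fin N) → A) :
    ∑ σ ∈ fix (insert l M), F (σ * swap k l) = ∑ τ ∈ fix M with τ k = l, F τ := by
  have hsw : ∀ j ∈ M, swap k l j = j := fun j hj =>
    swap_apply_of_ne_of_ne (by rintro rfl; exact hk hj) (by rintro rfl; exact hl hj)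
  refine sum_nbij' (· * swap k l) (· * swap k l) ?_ ?_ ?_ ?_ ?_
  · intro σ h
    rw [mem_fix] at h
    rw [mem_filter, mem_fix]
    refine ⟨fun j hj => ?_, ?_⟩
    · rw [Perm.mul_apply, hsw j hj, h j (mem_insert_of_mem hj)]
    · rw [Perm.mul_apply, swap_apply_left, h l (mem_insert_self _ _)]
  · intro σ h
    rw [mem_filter, mem_fix] at h
    rw [mem_fix]
    intro j hj
    rcases mem_insert.1 hj with rfl | hj
    · rw [Perm.mul_apply, swap_apply_right, h.2]
    · rw [Perm.mul_apply, hsw j hj, h.1 j hj]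
  · intro σ _; simp [mul_assoc]
  · intro σ _; simp [mul_assoc]
  · intro σ _; rfl

/-- Left multiplication by `(k l)` carries the permutations that fix `M ∪ {k}` to those that fix `M`
and send `k` to `l`. -/
theorem sum_fix_insert_swap_mul {A : Type*} [AddCommMonoid A] {M : Finset (Fin N)} {k l : Fin N}
    (hk : k ∉ M) (hl : l ∉ M) (F : Perm (Fin N) → A) :
    ∑ σ ∈ fix (insert k M), F (swap k l * σ) = ∑ τ ∈ fix M with τ k = l, F τ := by
  have hsw : ∀ j ∈ M, swap k l j = j := fun j hj =>
    swap_apply_of_ne_of_ne (by rintro rfl; exact hk hj) (by rintro rfl; exact hl hj)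
  refine sum_nbij' (swap k l * ·) (swap k l * ·) ?_ ?_ ?_ ?_ ?_
  · intro σ h
    rw [mem_fix] at h
    rw [mem_filter, mem_fix]
    refine ⟨fun j hj => ?_, ?_⟩
    · rw [Perm.mul_apply, h j (mem_insert_of_mem hj), hsw j hj]
    · rw [Perm.mul_apply, h k (mem_insert_self _ _), swap_apply_left]
  · intro σ h
    rw [mem_filter, mem_fix] at h
    rw [mem_fix]
    intro j hj
    rcases mem_insert.1 hj with rfl | hj
    · rw [Perm.mul_apply, h.2, swap_apply_right]
    · rw [Perm.mul_apply, h.1 j hj, hsw j hj]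
  · intro σ _; simp
  · intro σ _; simp
  · intro σ _; rfl

/-- Sorting the permutations that fix `M` and move `k` by the image of `k`. -/
theorem sum_fiber_apply {A : Type*} [AddCommMonoid A] {M : Finset (Fin N)} {k : Fin N}
    (hk : k ∉ M) (F : Perm (Fin N) → Fin N → A) :
    ∑ l ∈ (insert k M)ᶜ, ∑ τ ∈ fix M with τ k = l, F τ l =
      ∑ τ ∈ fix M with τ k ≠ k, F τ (τ k) := by
  rw [← sum_fiberwise_of_maps_to (s := {τ ∈ fix M | τ k ≠ k}) (t := (insert k M)ᶜ)
    (g := fun τ => τ k) ?_]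
  · refine sum_congr rfl fun l hl => ?_
    rw [filter_filter]
    simp only [mem_compl, mem_insert, not_or] at hl
    refine sum_congr ?_ ?_
    · ext τ
      simp only [mem_filter]
      constructor
      · rintro ⟨h, rfl⟩; exact ⟨h, hl.1, rfl⟩
      · rintro ⟨h, _, h'⟩; exact ⟨h, h'⟩
    · intro τ h
      simp only [mem_filter] at h
      rw [h.2.2]
  · intro τ h
    rw [mem_filter, mem_fix] at h
    simp only [mem_compl, mem_insert, not_or]
    exact ⟨h.2, fun h' => hk (by rwa [τ.injective (h.1 _ h')] at h')⟩

/-- When `x_k` passes `y_J`, the commutator arises with both `x_k` and `x_{σ(k)}`; the form chosen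
here has all `x` on the left. -/
theorem x_mul_term_sub_of_notMem {k : Fin N} {J : Finset (Fin N)} (hk : k ∉ J)
    {σ : Perm (Fin N)} (hσ : σ ∈ fix J) :
    D.x k * (D.xs J * D.ys J * D.perm σ) - D.xs J * D.ys J * D.perm σ * D.x k =
      D.x k * D.xs J * D.ys J * D.perm σ - D.x (σ k) * D.xs J * D.ys J * D.perm σ +
        ∑ l ∈ J, D.xs J * D.ys (J.erase l) * D.perm (σ * swap k l) := by
  rw [mem_fix] at hσ
  have hσk : σ k ∉ J := fun h => hk (by rwa [σ.injective (hσ _ h)] at h)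
  have h1 : ∀ l ∈ J, D.perm (σ * swap k l) = D.perm (swap (σ k) l) * D.perm σ := by
    intro l hl
    rw [mul_swap_eq_swap_mul, hσ l hl, map_mul]
  rw [sum_congr rfl fun l hl => by rw [h1 l hl]]
  have h2 := D.x_mul_ys hσk
  rw [← sub_eq_iff_eq_add] at h2
  have h3 : D.xs J * D.ys J * D.perm σ * D.x k = D.x (σ k) * D.xs J * D.ys J * D.perm σ -
      ∑ l ∈ J, D.xs J * D.ys (J.erase l) * (D.perm (swap (σ k) l) * D.perm σ) := by
    rw [mul_assoc, D.perm_mul_x, ← mul_assoc, mul_assoc _ _ (D.x (σ k)), ← h2, mul_sub, sub_mul,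
      ← mul_assoc, ← (D.x_commute_xs (σ k) J).eq, mul_sum, sum_mul]
    simp only [mul_assoc]
  rw [h3]
  simp only [mul_assoc]
  abel

theorem x_mul_term_sub_of_mem {k : Fin N} {M : Finset (Fin N)} (hk : k ∉ M)
    {σ : Perm (Fin N)} (hσ : σ ∈ fix (insert k M)) :
    D.x k * (D.xs (insert k M) * D.ys (insert k M) * D.perm σ) -
      D.xs (insert k M) * D.ys (insert k M) * D.perm σ * D.x k =
      -∑ a ∈ (insert k M)ᶜ, D.x k * D.xs M * D.ys M * D.perm (swap k a * σ) := by
  rw [mem_fix] at hσ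
  have h1 : D.perm σ * D.x k = D.x k * D.perm σ := by
    rw [D.perm_mul_x, hσ k (mem_insert_self _ _)]
  rw [mul_assoc _ (D.perm σ), h1, ← mul_assoc, ← mul_assoc, (D.x_commute_xs k _).eq, ← mul_assoc,
    mul_assoc _ (D.x k), D.x_mul_ys_insert hk, mul_assoc _ (D.ys _) (D.x k), ← sub_mul, ← mul_sub,
    sub_sub_cancel_left, mul_neg, neg_mul, mul_sum, sum_mul, ← D.xs_insert hk]
  simp only [map_mul, mul_assoc]

/-- The sets that contain `k` are the sets `M ∪ {k}` with `k ∉ M`. -/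
theorem sum_powerset_split {A : Type*} [AddCommMonoid A] {α : Type*} [DecidableEq α] [Fintype α]
    (k : α) (f : Finset α → A) :
    ∑ J, f J = ∑ M : Finset α with k ∉ M, (f M + f (insert k M)) := by
  rw [sum_add_distrib, ← sum_filter_add_sum_filter_not univ (fun M : Finset α => k ∉ M)]
  congr 1
  refine sum_nbij' (fun J => J.erase k) (fun M => insert k M) ?_ ?_ ?_ ?_ ?_
  · intro J _; simp
  · intro J _; simp
  · intro J h
    simp only [mem_filter, mem_univ, true_and, not_not] at h
    exact insert_erase h
  · intro J h
    simp only [mem_filter, mem_univ, true_and] at h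
    exact erase_insert h
  · intro J h
    simp only [mem_filter, mem_univ, true_and, not_not] at h
    rw [insert_erase h]

theorem theta_commute_x (k : Fin N) : Commute (D.x k) D.theta := by
  rw [commute_iff_eq, ← sub_eq_zero]
  -- the contribution of `(M, τ)` with the extra factor `x_l`
  let G : Finset (Fin N) → Perm (Fin N) → Fin N → Q := fun M τ l =>
    eps M τ • (D.x l * D.xs M * D.ys M * D.perm τ)
  have hin : ∀ M : Finset (Fin N), k ∉ M →
      ∑ σ ∈ fix (insert k M), eps (insert k M) σ •
        (D.x k * (D.xs (insert k M) * D.ys (insert k M) * D.perm σ) -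
        D.xs (insert k M) * D.ys (insert k M) * D.perm σ * D.x k) =
      -∑ τ ∈ fix M with τ k ≠ k, G M τ k := by
    intro M hk
    rw [← sum_fiber_apply hk fun τ _ => G M τ k, ← sum_neg_distrib]
    have : ∀ a ∈ (insert k M)ᶜ, -∑ τ ∈ fix M with τ k = a, G M τ k =
        -∑ σ ∈ fix (insert k M), G M (swap k a * σ) k := by
      intro a ha
      simp only [mem_compl, mem_insert, not_or] at ha
      rw [sum_fix_insert_swap_mul hk ha.2 fun τ => G M τ k]
    rw [sum_congr rfl this, sum_neg_distrib, sum_comm, ← sum_neg_distrib]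
    refine sum_congr rfl fun σ hσ => ?_
    rw [D.x_mul_term_sub_of_mem hk hσ, smul_neg, smul_sum]
    congr 1
    refine sum_congr rfl fun a ha => ?_
    simp only [mem_compl, mem_insert, not_or] at ha
    simp only [G]
    rw [eps_insert_swap_mul (Ne.symm ha.1) k hk]
  -- The transpositions inserted by commutators: sets `M ∪ {l}` become sets `M`.
  have hout : ∑ M : Finset (Fin N) with k ∉ M, ∑ σ ∈ fix M, eps M σ •
        ∑ l ∈ M, D.xs M * D.ys (M.erase l) * D.perm (σ * swap k l) =
      ∑ M : Finset (Fin N) with k ∉ M, ∑ τ ∈ fix M with τ k ≠ k, G M τ (τ k) := by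
    let f : Finset (Fin N) → Fin N → Q := fun M l =>
      if k ∉ insert l M then ∑ τ ∈ fix M with τ k = l, G M τ l else 0
    have e1 : ∀ M : Finset (Fin N), k ∉ M → ∑ σ ∈ fix M, eps M σ •
        ∑ l ∈ M, D.xs M * D.ys (M.erase l) * D.perm (σ * swap k l) =
        ∑ l ∈ M, f (M.erase l) l := by
      intro M hk
      simp only [smul_sum]
      rw [sum_comm]
      refine sum_congr rfl fun l hl => ?_
      simp only [f]
      rw [insert_erase hl, if_pos hk, ← sum_fix_insert_mul_swap (fun h => hk (mem_of_mem_erase h))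
        (notMem_erase l M), insert_erase hl]
      refine sum_congr rfl fun σ _ => ?_
      simp only [G]
      rw [eps_insert_mul_swap (by rintro rfl; exact hk hl) l (notMem_erase l M), insert_erase hl,
        ← D.xs_insert (notMem_erase l M), insert_erase hl]
    have e2 : ∀ M : Finset (Fin N), k ∈ M → ∑ l ∈ M, f (M.erase l) l = 0 := by
      intro M hk
      refine sum_eq_zero fun l hl => ?_
      simp only [f]
      rw [insert_erase hl, if_neg (not_not.2 hk)]
    have e3 : ∀ M : Finset (Fin N), k ∉ M → ∑ τ ∈ fix M with τ k ≠ k, G M τ (τ k) =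
        ∑ l ∈ Mᶜ, f M l := by
      intro M hk
      rw [← sum_fiber_apply hk fun τ l => G M τ l]
      rw [← sum_subset (compl_subset_compl.2 (subset_insert k M))]
      · refine sum_congr rfl fun l hl => ?_
        simp only [mem_compl, mem_insert, not_or] at hl
        simp only [f]
        rw [if_pos]
        simp only [mem_insert, not_or]
        exact ⟨Ne.symm hl.1, hk⟩
      · intro l hl hl'
        simp only [mem_compl, mem_insert, not_not] at hl hl'
        have : l = k := by tauto
        simp [f, this]
    have e4 : ∀ M : Finset (Fin N), k ∈ M → ∑ l ∈ Mᶜ, f M l = 0 := by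
      intro M hk
      refine sum_eq_zero fun l _ => ?_
      simp [f, hk]
    rw [sum_congr rfl fun M hM => e1 M (mem_filter.1 hM).2,
      sum_congr rfl fun M hM => e3 M (mem_filter.1 hM).2,
      sum_filter_of_ne (p := fun M : Finset (Fin N) => k ∉ M) fun M _ h hk => h (e2 M hk),
      sum_filter_of_ne (p := fun M : Finset (Fin N) => k ∉ M) fun M _ h hk => h (e4 M hk), sum_mem_eq_sum_notMem]
  have hexp : D.x k * D.theta - D.theta * D.x k = ∑ J, ∑ σ ∈ fix J, eps J σ •
      (D.x k * (D.xs J * D.ys J * D.perm σ) - D.xs J * D.ys J * D.perm σ * D.x k) := by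
    simp only [theta, mul_sum, sum_mul, ← sum_sub_distrib, smul_sub, mul_smul_comm,
      smul_mul_assoc]
  rw [hexp, sum_powerset_split k, sum_add_distrib,
    sum_congr rfl fun M hM => hin M (mem_filter.1 hM).2]
  have hsplit : ∀ M : Finset (Fin N), k ∉ M → ∑ σ ∈ fix M, eps M σ •
      (D.x k * (D.xs M * D.ys M * D.perm σ) - D.xs M * D.ys M * D.perm σ * D.x k) =
      ∑ σ ∈ fix M with σ k ≠ k, (G M σ k - G M σ (σ k)) + ∑ σ ∈ fix M, eps M σ •
        ∑ l ∈ M, D.xs M * D.ys (M.erase l) * D.perm (σ * swap k l) := by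
    intro M hk
    rw [sum_filter_of_ne (p := fun σ : Perm (Fin N) => σ k ≠ k), ← sum_add_distrib]
    · refine sum_congr rfl fun σ hσ => ?_
      rw [D.x_mul_term_sub_of_notMem hk hσ, smul_add, smul_sub]
    · intro σ _ h hσ
      rw [hσ, sub_self] at h
      exact h rfl
  rw [sum_congr rfl fun M hM => hsplit M (mem_filter.1 hM).2, sum_add_distrib, hout]
  simp only [sum_sub_distrib, sum_neg_distrib]
  abel

theorem theta_commute_perm (g : Perm (Fin N)) : Commute (D.perm g) D.theta := by
  rw [commute_iff_eq]
  have h1 : D.theta = ∑ J, ∑ σ, if ∀ j ∈ J, σ j = j then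
      eps J σ • (D.xs J * D.ys J * D.perm σ) else 0 := by
    simp only [theta, fix, sum_filter]
  conv_rhs => rw [h1]
  rw [← (Equiv.finsetCongr g).sum_comp]
  rw [sum_congr rfl fun J _ => ((MulAut.conj g).toEquiv.sum_comp _).symm]
  rw [h1, mul_sum, sum_mul]
  refine sum_congr rfl fun J _ => ?_
  rw [mul_sum, sum_mul]
  refine sum_congr rfl fun σ _ => ?_
  have hJ : (Equiv.finsetCongr g) J = J.image g := by
    simp [Equiv.finsetCongr, map_eq_image]
  have hfix : (∀ j ∈ (Equiv.finsetCongr g) J, (MulAut.conj g).toEquiv σ j = j) ↔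
      ∀ j ∈ J, σ j = j := by
    rw [hJ]
    simp [MulAut.conj_apply]
  simp only [hfix]
  split_ifs
  · have he : eps ((Equiv.finsetCongr g) J) ((MulAut.conj g).toEquiv σ) = eps J σ := by
      rw [hJ, eps, eps, card_image_of_injective _ g.injective]
      simp only [MulEquiv.toEquiv_eq_coe, MulEquiv.coe_toEquiv, MulAut.conj_apply, map_mul,
        map_inv, mul_inv_cancel_comm]
    rw [he, hJ, mul_smul_comm, smul_mul_assoc, ← mul_assoc, ← mul_assoc, D.perm_mul_xs,
      mul_assoc _ (D.perm g), D.perm_mul_ys]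
    simp only [MulEquiv.toEquiv_eq_coe, MulEquiv.coe_toEquiv, MulAut.conj_apply, mul_assoc,
      ← map_mul, inv_mul_cancel, mul_one]
  · simp

end CherednikSystem

/-! ### Evaluation of polynomials at commuting elements -/

/-- The evaluation of polynomials in several variables at pairwise commuting elements of an algebra
that need not be commutative. -/
theorem exists_commEval {R A ι : Type*} [CommRing R] [Ring A] [Algebra R A] (a : ι → A)
    (h : ∀ i j, Commute (a i) (a j)) :
    ∃ φ : MvPolynomial ι R →ₐ[R] A, ∀ i, φ (MvPolynomial.X i) = a i := by
  have := Algebra.isMulCommutative_adjoin R (s := Set.range a) (by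
    rintro _ ⟨i, rfl⟩ _ ⟨j, rfl⟩; exact h i j)
  let _ : CommRing (Algebra.adjoin R (Set.range a)) :=
    { (inferInstance : Ring (Algebra.adjoin R (Set.range a))) with
      mul_comm := this.is_comm.comm }
  refine ⟨(Algebra.adjoin R (Set.range a)).val.comp
    (MvPolynomial.aeval fun i => ⟨a i, Algebra.subset_adjoin ⟨i, rfl⟩⟩), fun i => ?_⟩
  rw [AlgHom.comp_apply, MvPolynomial.aeval_X]
  rfl

/-! ### The generators of the Cherednik algebra -/

theorem mk_surjective (N : ℕ) : Function.Surjective (mk N) :=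
  RingQuot.mkAlgHom_surjective ℂ (Rel N)

theorem exists_lift_mk {N : ℕ} {Q : Type*} [Ring Q] [Algebra ℂ Q] (f : FreeAlgebra ℂ (Gen N) →ₐ[ℂ] Q)
    (h : ∀ ⦃a b⦄, Rel N a b → f a = f b) : ∃ φ : H N →ₐ[ℂ] Q, ∀ a, φ (mk N a) = f a :=
  ⟨RingQuot.liftAlgHom ℂ ⟨f, h⟩, fun a => RingQuot.liftAlgHom_mkAlgHom_apply ℂ f h a⟩

-- Unfolding the ring structure of `H N` down to that of `RingQuot` obstructs the identification of
-- the instances that are derived from it along different paths.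
attribute [local irreducible] instRingH

theorem commute_hx {N : ℕ} (i j : Fin N) : Commute (hx i) (hx j) := by
  by_cases h : i = j
  · subst h; exact Commute.refl _
  · rw [commute_iff_eq, hx, hx, ← map_mul, ← map_mul, mk_rel (Rel.x_comm i j h)]

theorem commute_hy {N : ℕ} (i j : Fin N) : Commute (hy i) (hy j) := by
  by_cases h : i = j
  · subst h; exact Commute.refl _
  · rw [commute_iff_eq, hy, hy, ← map_mul, ← map_mul, mk_rel (Rel.y_comm i j h)]

theorem permH_mul_hx {N : ℕ} (g : Perm (Fin N)) (i : Fin N) :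
    permH N g * hx i = hx (g i) * permH N g := by
  induction g using Perm.swap_induction_on with
  | one => simp
  | swap_mul g a b hab ih =>
    rw [map_mul, mul_assoc, ih, ← mul_assoc, ← mul_assoc, permH_swap a b hab, Perm.mul_apply]
    congr 1
    generalize g i = j
    by_cases ha : j = a
    · subst ha
      rw [swap_apply_left, hs, hx, hx, ← map_mul, ← map_mul, mk_rel (Rel.s_mul_x j b hab)]
    by_cases hb : j = b
    · subst hb
      have : hs a j hab = hs j a hab.symm := mk_rel (Rel.s_symm a j hab)
      rw [swap_apply_right, this, hs, hx, hx, ← map_mul, ← map_mul,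
        mk_rel (Rel.s_mul_x j a hab.symm)]
    · rw [swap_apply_of_ne_of_ne ha hb, hs, hx, ← map_mul, ← map_mul,
        mk_rel (Rel.s_comm_x a b j hab (Ne.symm ha) (Ne.symm hb))]

theorem permH_mul_hy {N : ℕ} (g : Perm (Fin N)) (i : Fin N) :
    permH N g * hy i = hy (g i) * permH N g := by
  induction g using Perm.swap_induction_on with
  | one => simp
  | swap_mul g a b hab ih =>
    rw [map_mul, mul_assoc, ih, ← mul_assoc, ← mul_assoc, permH_swap a b hab, Perm.mul_apply]
    congr 1
    generalize g i = j
    by_cases ha : j = a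
    · subst ha
      rw [swap_apply_left, hs, hy, hy, ← map_mul, ← map_mul, mk_rel (Rel.s_mul_y j b hab)]
    by_cases hb : j = b
    · subst hb
      have : hs a j hab = hs j a hab.symm := mk_rel (Rel.s_symm a j hab)
      rw [swap_apply_right, this, hs, hy, hy, ← map_mul, ← map_mul,
        mk_rel (Rel.s_mul_y j a hab.symm)]
    · rw [swap_apply_of_ne_of_ne ha hb, hs, hy, ← map_mul, ← map_mul,
        mk_rel (Rel.s_comm_y a b j hab (Ne.symm ha) (Ne.symm hb))]

theorem hx_mul_hy {N : ℕ} (i j : Fin N) (h : i ≠ j) :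
    hx i * hy j = hy j * hx i + permH N (swap i j) := by
  have := mk_rel (Rel.x_y i j h)
  rw [map_sub, map_mul, map_mul, sub_eq_iff_eq_add, add_comm] at this
  rw [permH_swap i j h]
  exact this

theorem hx_mul_hy_self {N : ℕ} (i : Fin N) :
    hx i * hy i = hy i * hx i - ∑ a ∈ univ.erase i, permH N (swap i a) := by
  have := mk_rel (Rel.x_y_self i)
  rw [map_sub, map_mul, map_mul, sub_eq_iff_eq_add, add_comm, map_neg, map_sum,
    ← sub_eq_add_neg] at this
  refine this.trans ?_
  congr 1
  rw [sum_subtype (univ.erase i) (p := fun a => a ≠ i) (by simp)]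
  exact sum_congr rfl fun a _ => (permH_swap i a.1 a.2.symm).symm

/-- Polynomials in the `x_i` as elements of `H_N`. -/
noncomputable def polyX (N : ℕ) : MvPolynomial (Fin N) ℂ →ₐ[ℂ] H N :=
  (exists_commEval hx commute_hx).choose

/-- Polynomials in the `y_i` as elements of `H_N`. -/
noncomputable def polyY (N : ℕ) : MvPolynomial (Fin N) ℂ →ₐ[ℂ] H N :=
  (exists_commEval hy commute_hy).choose

@[simp] theorem polyX_X {N : ℕ} (i : Fin N) : polyX N (MvPolynomial.X i) = hx i :=
  (exists_commEval hx commute_hx).choose_spec i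

@[simp] theorem polyY_X {N : ℕ} (i : Fin N) : polyY N (MvPolynomial.X i) = hy i :=
  (exists_commEval hy commute_hy).choose_spec i

theorem permH_mul_polyX {N : ℕ} (g : Perm (Fin N)) (f : MvPolynomial (Fin N) ℂ) :
    permH N g * polyX N f = polyX N (MvPolynomial.rename g f) * permH N g := by
  induction f using MvPolynomial.induction_on with
  | C a => simp [← MvPolynomial.algebraMap_eq, Algebra.commutes]
  | add p q hp hq => simp [mul_add, add_mul, hp, hq]
  | mul_X p i hp =>
    rw [map_mul, ← mul_assoc, hp, mul_assoc, polyX_X, permH_mul_hx, ← mul_assoc, map_mul, map_mul,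
      MvPolynomial.rename_X, polyX_X]

theorem permH_mul_polyY {N : ℕ} (g : Perm (Fin N)) (f : MvPolynomial (Fin N) ℂ) :
    permH N g * polyY N f = polyY N (MvPolynomial.rename g f) * permH N g := by
  induction f using MvPolynomial.induction_on with
  | C a => simp [← MvPolynomial.algebraMap_eq, Algebra.commutes]
  | add p q hp hq => simp [mul_add, add_mul, hp, hq]
  | mul_X p i hp =>
    rw [map_mul, ← mul_assoc, hp, mul_assoc, polyY_X, permH_mul_hy, ← mul_assoc, map_mul, map_mul,
      MvPolynomial.rename_X, polyY_X]

/-! ### Normal ordering -/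

theorem polyX_monomial {N : ℕ} (m : Fin N →₀ ℕ) :
    polyX N (MvPolynomial.monomial m 1) = (List.ofFn fun i : Fin N => hx i ^ m i).prod := by
  have : MvPolynomial.monomial m (1 : ℂ) =
      (List.ofFn fun i : Fin N => MvPolynomial.X i ^ m i).prod := by
    rw [MvPolynomial.monomial_eq, map_one, one_mul, List.prod_ofFn,
      Finsupp.prod_fintype _ _ fun i => pow_zero _]
  rw [this, map_list_prod, List.map_ofFn]
  simp [Function.comp_def]

theorem polyY_monomial {N : ℕ} (m : Fin N →₀ ℕ) :
    polyY N (MvPolynomial.monomial m 1) = (List.ofFn fun i : Fin N => hy i ^ m i).prod := by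
  have : MvPolynomial.monomial m (1 : ℂ) =
      (List.ofFn fun i : Fin N => MvPolynomial.X i ^ m i).prod := by
    rw [MvPolynomial.monomial_eq, map_one, one_mul, List.prod_ofFn,
      Finsupp.prod_fintype _ _ fun i => pow_zero _]
  rw [this, map_list_prod, List.map_ofFn]
  simp [Function.comp_def]

/-- The exponents of the `x_i` and of the `y_i` in a monomial. -/
noncomputable abbrev splitExp {N : ℕ} (m : Fin N ⊕ Fin N →₀ ℕ) :
    (Fin N →₀ ℕ) × (Fin N →₀ ℕ) :=
  Finsupp.sumFinsuppEquivProdFinsupp m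

theorem normalOrder_monomial_one {N : ℕ} (m : Fin N ⊕ Fin N →₀ ℕ) :
    normalOrder N (MvPolynomial.monomial m 1) =
      polyX N (MvPolynomial.monomial (splitExp m).1 1) *
        polyY N (MvPolynomial.monomial (splitExp m).2 1) := by
  have := (MvPolynomial.basisMonomials (Fin N ⊕ Fin N) ℂ).constr_basis ℂ (fun m =>
    (List.ofFn fun i : Fin N => hx i ^ m (Sum.inl i)).prod *
      (List.ofFn fun i : Fin N => hy i ^ m (Sum.inr i)).prod) m
  rw [MvPolynomial.coe_basisMonomials] at this
  rw [normalOrder, this, polyX_monomial, polyY_monomial]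
  rfl

theorem monomial_splitExp {N : ℕ} (m : Fin N ⊕ Fin N →₀ ℕ) (a b : ℂ) :
    MvPolynomial.rename Sum.inl (MvPolynomial.monomial (splitExp m).1 a) *
      MvPolynomial.rename Sum.inr (MvPolynomial.monomial (splitExp m).2 b) =
    MvPolynomial.monomial m (a * b) := by
  rw [MvPolynomial.rename_monomial, MvPolynomial.rename_monomial, MvPolynomial.monomial_mul]
  refine congrArg (fun e => MvPolynomial.monomial e (a * b)) (Finsupp.ext fun i => ?_)
  rcases i with i | i
  · rw [Finsupp.add_apply, Finsupp.mapDomain_apply Sum.inl_injective,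
      Finsupp.mapDomain_of_notMem_range _ _ (by simp), add_zero]
    rfl
  · rw [Finsupp.add_apply, Finsupp.mapDomain_apply Sum.inr_injective,
      Finsupp.mapDomain_of_notMem_range _ _ (by simp), zero_add]
    rfl

theorem normalOrder_mul {N : ℕ} (f g : MvPolynomial (Fin N) ℂ) :
    normalOrder N (MvPolynomial.rename Sum.inl f * MvPolynomial.rename Sum.inr g) =
      polyX N f * polyY N g := by
  induction f using MvPolynomial.induction_on' with
  | add p q hp hq => simp only [map_add, add_mul, hp, hq]
  | monomial u a =>
    induction g using MvPolynomial.induction_on' with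
    | add p q hp hq => simp only [map_add, mul_add, hp, hq]
    | monomial v b =>
      obtain ⟨m, hm⟩ := Finsupp.sumFinsuppEquivProdFinsupp.surjective (u, v)
      have h1 : u = (splitExp m).1 := by rw [splitExp, hm]
      have h2 : v = (splitExp m).2 := by rw [splitExp, hm]
      have e : ∀ {τ : Type} (w : τ →₀ ℕ) (r : ℂ),
          MvPolynomial.monomial w r = r • MvPolynomial.monomial w (1 : ℂ) := by
        intro τ w r
        rw [MvPolynomial.smul_monomial, smul_eq_mul, mul_one]
      rw [h1, h2, monomial_splitExp, e m, e _ a, e _ b, map_smul, map_smul, map_smul,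
        normalOrder_monomial_one, smul_mul_smul_comm]

/-! ### Every element is a combination of normally ordered polynomials and permutations -/

/-- The span of the products `q(x) p(y) σ`. -/
noncomputable def normalSpan (N : ℕ) : Submodule ℂ (H N) :=
  Submodule.span ℂ {z | ∃ f g σ, z = polyX N f * polyY N g * permH N σ}

theorem mem_normalSpan {N : ℕ} (f g : MvPolynomial (Fin N) ℂ) (σ : Perm (Fin N)) :
    polyX N f * polyY N g * permH N σ ∈ normalSpan N :=
  Submodule.subset_span ⟨f, g, σ, rfl⟩

/-- The commutator of `y_k` with a polynomial in the `x_i` involves only the `x_i` and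
permutations. -/
theorem hy_mul_polyX_sub_mem {N : ℕ} (k : Fin N) (f : MvPolynomial (Fin N) ℂ) :
    hy k * polyX N f - polyX N f * hy k ∈
      Submodule.span ℂ {z | ∃ f σ, z = polyX N f * permH N σ} := by
  set V := Submodule.span ℂ {z | ∃ f σ, z = polyX N f * permH N σ} with hV
  have hperm : ∀ (p : MvPolynomial (Fin N) ℂ) σ, polyX N p * permH N σ ∈ V := fun p σ =>
    Submodule.subset_span ⟨p, σ, rfl⟩
  induction f using MvPolynomial.induction_on with
  | C a => simp [← MvPolynomial.algebraMap_eq, Algebra.commutes]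
  | add p q hp hq =>
    have : hy k * polyX N (p + q) - polyX N (p + q) * hy k =
      (hy k * polyX N p - polyX N p * hy k) + (hy k * polyX N q - polyX N q * hy k) := by
      rw [map_add]; noncomm_ring
    rw [this]
    exact V.add_mem hp hq
  | mul_X p i hp =>
    have : hy k * polyX N (p * MvPolynomial.X i) - polyX N (p * MvPolynomial.X i) * hy k =
      (hy k * polyX N p - polyX N p * hy k) * hx i - polyX N p * (hx i * hy k - hy k * hx i) := by
      rw [map_mul, polyX_X]; noncomm_ring
    have h1 : (hy k * polyX N p - polyX N p * hy k) * hx i ∈ V := by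
      generalize hy k * polyX N p - polyX N p * hy k = z at hp
      rw [hV] at hp
      induction hp using Submodule.span_induction with
      | mem z hz =>
        obtain ⟨f, σ, rfl⟩ := hz
        rw [mul_assoc, permH_mul_hx, ← mul_assoc, ← polyX_X, ← map_mul]
        exact hperm _ _
      | zero => rw [zero_mul]; exact V.zero_mem
      | add x y _ _ hx hy => rw [add_mul]; exact V.add_mem hx hy
      | smul a x _ hx => rw [smul_mul_assoc]; exact V.smul_mem _ hx
    have h2 : polyX N p * (hx i * hy k - hy k * hx i) ∈ V := by
      by_cases hik : i = k
      · subst hik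
        rw [hx_mul_hy_self, sub_sub_cancel_left, mul_neg, mul_sum]
        exact V.neg_mem (V.sum_mem fun a _ => hperm _ _)
      · rw [hx_mul_hy i k hik, add_sub_cancel_left]
        exact hperm _ _
    rw [this]
    exact V.sub_mem h1 h2

theorem gen_mul_mem_normalSpan {N : ℕ} (a : Gen N) {w : H N} (hw : w ∈ normalSpan N) :
    mk N (FreeAlgebra.ι ℂ a) * w ∈ normalSpan N := by
  induction hw using Submodule.span_induction with
  | zero => rw [mul_zero]; exact Submodule.zero_mem _
  | add x y _ _ hx hy => rw [mul_add]; exact Submodule.add_mem _ hx hy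
  | smul a x _ hx => rw [mul_smul_comm]; exact Submodule.smul_mem _ _ hx
  | mem z hz =>
    obtain ⟨f, g, σ, rfl⟩ := hz
    cases a with
    | x i =>
      change hx i * _ ∈ _
      rw [← polyX_X, ← mul_assoc, ← mul_assoc, ← map_mul]
      exact mem_normalSpan _ _ _
    | s j k h =>
      change hs j k h * _ ∈ _
      rw [← permH_swap, ← mul_assoc, ← mul_assoc, permH_mul_polyX, mul_assoc _ (permH N _),
        permH_mul_polyY, mul_assoc, mul_assoc, ← map_mul, ← mul_assoc]
      exact mem_normalSpan _ _ _
    | y k =>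
      change hy k * _ ∈ _
      have : hy k * (polyX N f * polyY N g * permH N σ) =
          (hy k * polyX N f - polyX N f * hy k) * (polyY N g * permH N σ) +
            polyX N f * polyY N (MvPolynomial.X k * g) * permH N σ := by
        rw [map_mul, polyY_X]; noncomm_ring
      rw [this]
      refine Submodule.add_mem _ ?_ (mem_normalSpan _ _ _)
      have hp := hy_mul_polyX_sub_mem k f
      generalize hy k * polyX N f - polyX N f * hy k = z at hp
      induction hp using Submodule.span_induction with
      | zero => rw [zero_mul]; exact Submodule.zero_mem _
      | add x y _ _ hx hy => rw [add_mul]; exact Submodule.add_mem _ hx hy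
      | smul a x _ hx => rw [smul_mul_assoc]; exact Submodule.smul_mem _ _ hx
      | mem z hz =>
        obtain ⟨f', τ, rfl⟩ := hz
        rw [mul_assoc, ← mul_assoc (permH N τ), permH_mul_polyY, mul_assoc (polyY N _), ← map_mul,
          ← mul_assoc]
        exact mem_normalSpan _ _ _

theorem normalSpan_eq_top (N : ℕ) : normalSpan N = ⊤ := by
  have key : ∀ a : FreeAlgebra ℂ (Gen N), ∀ w ∈ normalSpan N, mk N a * w ∈ normalSpan N := by
    intro a
    induction a using FreeAlgebra.induction with
    | grade0 r =>
      intro w hw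
      rw [AlgHom.commutes, ← Algebra.smul_def]
      exact Submodule.smul_mem _ _ hw
    | grade1 a => exact fun w hw => gen_mul_mem_normalSpan a hw
    | mul a b ha hb =>
      intro w hw
      rw [map_mul, mul_assoc]
      exact ha _ (hb _ hw)
    | add a b ha hb =>
      intro w hw
      rw [map_add, add_mul]
      exact Submodule.add_mem _ (ha _ hw) (hb _ hw)
  rw [eq_top_iff]
  rintro z -
  obtain ⟨a, rfl⟩ : ∃ a, mk N a = z := mk_surjective N z
  have h1 : (1 : H N) ∈ normalSpan N := by
    have := mem_normalSpan (N := N) 1 1 1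
    simpa using this
  simpa using key a 1 h1

theorem exists_eq_sum_normalOrder {N : ℕ} (z : H N) :
    ∃ q : Perm (Fin N) → XY N, z = ∑ σ, normalOrder N (q σ) * permH N σ := by
  have hz : z ∈ normalSpan N := by rw [normalSpan_eq_top]; trivial
  induction hz using Submodule.span_induction with
  | zero => exact ⟨0, by simp⟩
  | add x y _ _ hx hy =>
    obtain ⟨p, rfl⟩ := hx
    obtain ⟨q, rfl⟩ := hy
    exact ⟨p + q, by simp [add_mul, sum_add_distrib]⟩
  | smul a x _ hx =>
    obtain ⟨p, rfl⟩ := hx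
    exact ⟨a • p, by simp [smul_sum]⟩
  | mem z hz =>
    obtain ⟨f, g, σ, rfl⟩ := hz
    refine ⟨Pi.single σ (MvPolynomial.rename Sum.inl f * MvPolynomial.rename Sum.inr g), ?_⟩
    rw [sum_eq_single σ, Pi.single_eq_same, normalOrder_mul]
    · intro τ _ h
      rw [Pi.single_eq_of_ne h, map_zero, zero_mul]
    · simp

theorem mem_center_of_commute {N : ℕ} {z : H N} (hX : ∀ i, Commute z (hx i))
    (hY : ∀ i, Commute z (hy i)) (hP : ∀ σ, Commute z (permH N σ)) :
    z ∈ Subalgebra.center ℂ (H N) := by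
  rw [Subalgebra.mem_center_iff]
  intro b
  obtain ⟨a, rfl⟩ : ∃ a, mk N a = b := mk_surjective N b
  change Commute (mk N a) z
  induction a using FreeAlgebra.induction with
  | grade0 r => rw [AlgHom.commutes]; exact Algebra.commutes _ _
  | grade1 a =>
    cases a with
    | x i => exact (hX i).symm
    | y i => exact (hY i).symm
    | s j k h => have := (hP (swap j k)).symm; rwa [permH_swap j k h] at this
  | mul a b ha hb => rw [map_mul]; exact ha.mul_left hb
  | add a b ha hb => rw [map_add]; exact ha.add_left hb

/-! ### The universal central polynomial as an alternating sum over subsets -/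

theorem commute_X_sub_C {R : Type*} [Ring R] {a b : R} (h : Commute a b) :
    Commute (X - C a) (X - C b) := by
  have h' : C a * C b = C b * C a := by rw [← C_mul, ← C_mul, h.eq]
  rw [commute_iff_eq]
  simp only [sub_mul, mul_sub, X_mul_C, h']
  abel

/-- The elements `v - x_i` and `u - y_i`, where `u` and `v` are central variables, satisfy the same
relations as `x_i` and `y_i`. -/
noncomputable def CherednikSystem.shift {N : ℕ} {Q : Type*} [Ring Q] (D : CherednikSystem N Q) :
    CherednikSystem N Q[X][X] where
  perm := ((C.comp C : Q →+* Q[X][X]) : Q →* Q[X][X]).comp D.perm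
  x i := X - C (C (D.x i))
  y i := C (X - C (D.y i))
  x_comm i j := commute_X_sub_C (by rw [commute_iff_eq, ← C_mul, ← C_mul, (D.x_comm i j).eq])
  y_comm i j := by rw [commute_iff_eq, ← C_mul, ← C_mul, (commute_X_sub_C (D.y_comm i j)).eq]
  perm_mul_x g i := by
    simp only [MonoidHom.coe_comp, MonoidHom.coe_coe, RingHom.coe_comp, Function.comp_apply,
      mul_sub, sub_mul, ← C_mul, D.perm_mul_x, X_mul_C]
  perm_mul_y g i := by
    simp only [MonoidHom.coe_comp, MonoidHom.coe_coe, RingHom.coe_comp, Function.comp_apply,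
      mul_sub, sub_mul, ← C_mul, D.perm_mul_y, X_mul_C]
  x_mul_y i j h := by
    simp only [MonoidHom.coe_comp, MonoidHom.coe_coe, RingHom.coe_comp, Function.comp_apply,
      sub_mul, mul_sub, X_mul_C, ← C_mul, D.x_mul_y i j h, C_add, C_sub]
    abel
  x_mul_y_self i := by
    simp only [MonoidHom.coe_comp, MonoidHom.coe_coe, RingHom.coe_comp, Function.comp_apply,
      sub_mul, mul_sub, X_mul_C, ← C_mul, D.x_mul_y_self i, C_sub, map_sum]
    abel

/-- The generators of the rational Cherednik algebra. -/
noncomputable def systemH (N : ℕ) : CherednikSystem N (H N) where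
  perm := permH N
  x := hx
  y := hy
  x_comm := commute_hx
  y_comm := commute_hy
  perm_mul_x := permH_mul_hx
  perm_mul_y := permH_mul_hy
  x_mul_y := hx_mul_hy
  x_mul_y_self := hx_mul_hy_self

/-- The polynomial `∏_{j ∈ J} (t - x_j)`. -/
noncomputable def rootPoly {N : ℕ} (J : Finset (Fin N)) : (MvPolynomial (Fin N) ℂ)[X] :=
  ∏ j ∈ J, (X - C (MvPolynomial.X j))

theorem shift_xs {N : ℕ} (J : Finset (Fin N)) :
    (systemH N).shift.xs J = (rootPoly J).map (C.comp (polyX N : _ →+* H N)) := by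
  induction J using Finset.induction_on with
  | empty => simp [rootPoly]
  | insert a J ha ih =>
    rw [CherednikSystem.xs_insert _ ha, ih, rootPoly, rootPoly, prod_insert ha, Polynomial.map_mul]
    simp [CherednikSystem.shift, systemH]

theorem shift_ys {N : ℕ} (J : Finset (Fin N)) :
    (systemH N).shift.ys J = C ((rootPoly J).map (polyY N : _ →+* H N)) := by
  induction J using Finset.induction_on with
  | empty => simp [rootPoly]
  | insert a J ha ih =>
    rw [CherednikSystem.ys_insert _ ha, ih, rootPoly, rootPoly, prod_insert ha, Polynomial.map_mul]
    simp [CherednikSystem.shift, systemH]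

theorem coeff_normalOrderPoly {N : ℕ} (p : (XY N)[X][X]) (a b : ℕ) :
    ((normalOrderPoly N p).coeff a).coeff b = normalOrder N ((p.coeff a).coeff b) := by
  have h : ∀ q : (XY N)[X],
      (q.sum fun b r => monomial b (normalOrder N r)).coeff b = normalOrder N (q.coeff b) := by
    intro q
    rw [Polynomial.coeff_sum, Polynomial.sum_def, sum_eq_single b]
    · simp
    · intro n _ hn
      rw [coeff_monomial, if_neg hn]
    · intro hb
      rw [notMem_support_iff.1 hb]
      simp
  rw [normalOrderPoly, Polynomial.coeff_sum, Polynomial.sum_def, sum_eq_single a]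
  · rw [coeff_monomial, if_pos rfl, h]
  · intro n _ hn
    rw [coeff_monomial, if_neg hn]
  · intro ha
    rw [notMem_support_iff.1 ha]
    simp

/-- Normal ordering of coefficients as an additive map. -/
noncomputable def normalOrderPolyHom (N : ℕ) : (XY N)[X][X] →+ (H N)[X][X] where
  toFun := normalOrderPoly N
  map_zero' := by ext a b; simp [coeff_normalOrderPoly]
  map_add' p q := by ext a b; simp [coeff_normalOrderPoly]

theorem normalOrderPolyHom_apply {N : ℕ} (p : (XY N)[X][X]) :
    normalOrderPolyHom N p = normalOrderPoly N p := rfl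

theorem normalOrderPoly_mul {N : ℕ} (p q : (MvPolynomial (Fin N) ℂ)[X]) :
    normalOrderPoly N (p.map (C.comp (MvPolynomial.rename Sum.inl : _ →ₐ[ℂ] XY N).toRingHom) *
      C (q.map (MvPolynomial.rename Sum.inr : _ →ₐ[ℂ] XY N).toRingHom)) =
    p.map (C.comp (polyX N : _ →+* H N)) * C (q.map (polyY N : _ →+* H N)) := by
  ext a b
  rw [coeff_normalOrderPoly]
  simp only [coeff_mul_C, coeff_map, RingHom.comp_apply, coeff_C_mul]
  exact normalOrder_mul _ _

theorem normalOrderPoly_prod {N : ℕ} (J : Finset (Fin N)) :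
    normalOrderPoly N (∏ i ∈ J, ((X - C (C (MvPolynomial.X (Sum.inl i)))) *
      (C X - C (C (MvPolynomial.X (Sum.inr i)))))) =
    (systemH N).shift.xs J * (systemH N).shift.ys J := by
  rw [shift_xs, shift_ys, ← normalOrderPoly_mul, prod_mul_distrib, rootPoly,
    Polynomial.map_prod, Polynomial.map_prod, map_prod]
  simp

theorem prod_one_sub {R ι : Type*} [CommRing R] (f : ι → R) (s : Finset ι) :
    ∏ i ∈ s, (1 - f i) = ∑ J ∈ s.powerset, ((-1) ^ #J : ℤ) • ∏ i ∈ J, f i := by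
  simp only [sub_eq_add_neg]
  rw [prod_one_add]
  refine sum_congr rfl fun J _ => ?_
  rw [prod_neg, zsmul_eq_mul]
  simp

theorem centralPoly_eq (N : ℕ) : centralPoly N = (-1) ^ N * (systemH N).shift.theta := by
  rw [centralPoly]
  congr 1
  have h1 : ∀ σ : Perm (Fin N), normalOrderPoly N (∏ i : Fin N with σ i = i, centralFactor i) =
      ∑ J ∈ powerset {i : Fin N | σ i = i}, ((-1) ^ #J : ℤ) •
        ((systemH N).shift.xs J * (systemH N).shift.ys J) := by
    intro σ
    simp only [centralFactor]
    refine (congrArg (normalOrderPolyHom N) (prod_one_sub _ _)).trans ?_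
    rw [map_sum]
    refine sum_congr rfl fun J _ => ?_
    rw [map_zsmul, normalOrderPolyHom_apply, normalOrderPoly_prod]
  have h2 : (systemH N).shift.theta = ∑ J, ∑ σ, if ∀ j ∈ J, σ j = j then
      CherednikSystem.eps J σ • ((systemH N).shift.xs J * (systemH N).shift.ys J *
        (systemH N).shift.perm σ) else 0 := by
    simp only [CherednikSystem.theta, CherednikSystem.fix, sum_filter]
  rw [h2, sum_comm]
  refine sum_congr rfl fun σ _ => ?_
  rw [h1, sum_mul, ← sum_filter]
  refine sum_congr ?_ fun J _ => ?_
  · ext J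
    simp [subset_iff]
  · have : (systemH N).shift.perm σ = C (C (permH N σ)) := rfl
    rw [this, CherednikSystem.eps, mul_smul, smul_mul_assoc, ← zsmul_eq_mul, mul_smul_comm]

theorem commute_coeff {A : Type*} [Ring A] {a : A} {p : A[X][X]} (h : Commute (C (C a)) p)
    (m n : ℕ) : Commute ((p.coeff m).coeff n) a := by
  have := congrArg (fun q => (coeff q m).coeff n) h.eq
  simp only [coeff_C_mul, coeff_mul_C] at this
  exact this.symm

theorem CherednikSystem.commute_C_C_theta_shift {N : ℕ} {Q : Type*} [Ring Q]
    (D : CherednikSystem N Q) (k : Fin N) : Commute (C (C (D.x k))) D.shift.theta := by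
  have h2 : C (C (D.x k)) = X - D.shift.x k := (sub_sub_cancel _ _).symm
  rw [h2]
  exact Commute.sub_left (commute_X _) (D.shift.theta_commute_x k)

theorem commute_neg_one_pow_mul {R : Type*} [Ring R] {a b : R} (n : ℕ) (h : Commute a b) :
    Commute a ((-1) ^ n * b) :=
  Commute.mul_right ((Commute.neg_one_right a).pow_right n) h

theorem commute_c_hx {N : ℕ} (i j : Fin (N + 1)) (k : Fin N) : Commute (c i j) (hx k) := by
  refine commute_coeff ?_ _ _
  rw [centralPoly_eq]
  exact commute_neg_one_pow_mul _ ((systemH N).commute_C_C_theta_shift k)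

theorem commute_c_permH {N : ℕ} (i j : Fin (N + 1)) (σ : Perm (Fin N)) :
    Commute (c i j) (permH N σ) := by
  refine commute_coeff ?_ _ _
  rw [centralPoly_eq]
  exact commute_neg_one_pow_mul _ ((systemH N).shift.theta_commute_perm σ)

theorem coeff_centralPoly {N : ℕ} (a b : ℕ) : ((centralPoly N).coeff a).coeff b =
    ∑ J, ∑ σ ∈ CherednikSystem.fix J, ((-1) ^ N * CherednikSystem.eps J σ) •
      (polyX N ((rootPoly J).coeff a) * polyY N ((rootPoly J).coeff b) * permH N σ) := by
  have h : ∀ σ : Perm (Fin N), (systemH N).shift.perm σ = C (C (permH N σ)) := fun _ => rfl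
  have h' : ((-1) ^ N : (H N)[X][X]) = (((-1) ^ N : ℤ) : (H N)[X][X]) := by simp
  rw [centralPoly_eq, h', ← zsmul_eq_mul, CherednikSystem.theta]
  simp only [mul_smul, ← smul_sum, coeff_smul, finsetSum_coeff, shift_xs,
    shift_ys, h, coeff_mul_C, coeff_map, coeff_C_mul, RingHom.comp_apply]
  rfl

/-! ### The field of rational functions and its skew group algebra -/

/-- Simultaneous permutation of the `x_i` and of the `y_i`. -/
noncomputable instance instActionXY (N : ℕ) : MulSemiringAction (Perm (Fin N)) (XY N) where
  smul σ f := MvPolynomial.rename (Sum.map σ σ) f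
  one_smul f := by
    change MvPolynomial.rename _ f = f
    simp
  mul_smul σ τ f := by
    change MvPolynomial.rename _ f = MvPolynomial.rename _ (MvPolynomial.rename _ f)
    rw [MvPolynomial.rename_rename, Sum.map_comp_map]
    rfl
  smul_zero σ := map_zero (MvPolynomial.rename (Sum.map σ σ))
  smul_add σ := map_add (MvPolynomial.rename (Sum.map σ σ))
  smul_one σ := map_one (MvPolynomial.rename (Sum.map σ σ))
  smul_mul σ := map_mul (MvPolynomial.rename (Sum.map σ σ))

theorem smul_XY {N : ℕ} (σ : Perm (Fin N)) (f : XY N) :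
    σ • f = MvPolynomial.rename (Sum.map σ σ) f := rfl

/-- The field of rational functions in the `x_i` and the `p_i`. -/
def RatXP (N : ℕ) : Type := FractionRing (XY N)

namespace RatXP

variable {N : ℕ}

noncomputable instance : Field (RatXP N) := inferInstanceAs (Field (FractionRing (XY N)))

noncomputable instance : Algebra (XY N) (RatXP N) :=
  inferInstanceAs (Algebra (XY N) (FractionRing (XY N)))

noncomputable instance : Algebra ℂ (RatXP N) := inferInstanceAs (Algebra ℂ (FractionRing (XY N)))

instance : IsFractionRing (XY N) (RatXP N) :=
  inferInstanceAs (IsFractionRing (XY N) (FractionRing (XY N)))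

instance : IsScalarTower ℂ (XY N) (RatXP N) :=
  inferInstanceAs (IsScalarTower ℂ (XY N) (FractionRing (XY N)))

noncomputable instance : MulSemiringAction (Perm (Fin N)) (RatXP N) :=
  IsFractionRing.mulSemiringAction (Perm (Fin N)) (XY N) (RatXP N)

instance : SMulDistribClass (Perm (Fin N)) (XY N) (RatXP N) :=
  IsFractionRing.smulDistribClass (Perm (Fin N)) (XY N) (RatXP N)

/-- Polynomials as rational functions. -/
noncomputable def ofPoly (N : ℕ) : XY N →ₐ[ℂ] RatXP N := IsScalarTower.toAlgHom ℂ (XY N) (RatXP N)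

theorem ofPoly_injective : Function.Injective (ofPoly N) :=
  IsFractionRing.injective (XY N) (RatXP N)

theorem smul_ofPoly (σ : Perm (Fin N)) (f : XY N) : σ • ofPoly N f = ofPoly N (σ • f) :=
  (algebraMap.coe_smul' σ f (RatXP N)).symm

instance : SMulCommClass (Perm (Fin N)) ℂ (RatXP N) where
  smul_comm σ r f := by
    have h : algebraMap ℂ (RatXP N) r = ofPoly N (MvPolynomial.C r) :=
      ((ofPoly N).commutes r).symm
    rw [Algebra.smul_def, smul_mul', h, smul_ofPoly, smul_XY, MvPolynomial.rename_C, ← h,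
      ← Algebra.smul_def]

/-- The rational function `x_i`. -/
noncomputable def x (i : Fin N) : RatXP N := ofPoly N (MvPolynomial.X (Sum.inl i))

/-- The rational function `p_i`. -/
noncomputable def p (i : Fin N) : RatXP N := ofPoly N (MvPolynomial.X (Sum.inr i))

@[simp] theorem smul_x (σ : Perm (Fin N)) (i : Fin N) : σ • x i = x (σ i) := by
  rw [x, smul_ofPoly, smul_XY, MvPolynomial.rename_X]
  rfl

@[simp] theorem smul_p (σ : Perm (Fin N)) (i : Fin N) : σ • p i = p (σ i) := by
  rw [p, smul_ofPoly, smul_XY, MvPolynomial.rename_X]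
  rfl

theorem x_injective : Function.Injective (x : Fin N → RatXP N) := fun _ _ h =>
  Sum.inl_injective (MvPolynomial.X_injective (ofPoly_injective h))

theorem x_sub_x_ne_zero {i j : Fin N} (h : i ≠ j) : x i - x j ≠ 0 :=
  sub_ne_zero.2 fun e => h (x_injective e)

end RatXP

/-- The skew group algebra of the symmetric group over the field of rational functions. -/
abbrev SkewXP (N : ℕ) : Type := SkewMonoidAlgebra (RatXP N) (Perm (Fin N))

open RatXP
open SkewMonoidAlgebra (single single_mul_single coeff_single coeffAddEquiv coeffAddEquiv_apply
  coeff_mul_single_one coeff_single_one_mul coeff_single_mul single_neg single_add single_zero of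
  of_apply)

/-- An element of the skew group algebra that commutes with all the `x_k` is a rational function. -/
theorem eq_single_one_of_commute {N : ℕ} {b : SkewXP N}
    (h : ∀ k, Commute b (single 1 (x k))) : b = single 1 (b.coeff 1) := by
  refine SkewMonoidAlgebra.ext fun σ => ?_
  by_cases hσ : σ = 1
  · subst hσ; simp
  · rw [coeff_single, Finsupp.single_eq_of_ne hσ]
    obtain ⟨k, hk⟩ : ∃ k, σ k ≠ k := by
      by_contra! h'
      exact hσ (Equiv.ext h')
    have h1 := congrArg (fun z => z.coeff σ) (h k).eq
    simp only [coeff_mul_single_one, coeff_single_one_mul, smul_x] at h1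
    have h2 : b.coeff σ * (x (σ k) - x k) = 0 := by rw [mul_sub, h1]; ring
    exact (mul_eq_zero.1 h2).resolve_right (x_sub_x_ne_zero hk)

/-! ### Dunkl operators -/

section Dunkl

variable {N : ℕ}

/-- The part `∑_{a ≠ i} (x_i - x_a)⁻¹ s_{ia}` of the Dunkl operator. The summand with `a = i`
vanishes, since the inverse of zero is zero. -/
noncomputable def dunklSum (i : Fin N) : SkewXP N := ∑ a, single (swap i a) (x i - x a)⁻¹

theorem coeff_dunklSum (i : Fin N) (τ : Perm (Fin N)) :
    (dunklSum i).coeff τ = if swap i (τ i) = τ then (x i - x (τ i))⁻¹ else 0 := by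
  classical
  rw [dunklSum, ← coeffAddEquiv_apply, map_sum, Finsupp.finsetSum_apply, sum_eq_single (τ i)]
  · rw [coeffAddEquiv_apply, coeff_single, Finsupp.single_apply]
  · intro a _ ha
    rw [coeffAddEquiv_apply, coeff_single, Finsupp.single_apply, if_neg]
    rintro rfl
    simp at ha
  · simp

theorem perm_mul_dunklSum (g : Perm (Fin N)) (i : Fin N) :
    single g 1 * dunklSum i = dunklSum (g i) * single g 1 := by
  rw [dunklSum, dunklSum, mul_sum, sum_mul]
  conv_rhs => rw [← Equiv.sum_comp g]
  refine sum_congr rfl fun a _ => ?_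
  rw [single_mul_single, single_mul_single, mul_swap_eq_swap_mul, smul_one, mul_one, one_mul,
    smul_inv'', smul_sub, smul_x, smul_x]

theorem dunklSum_mul_sub (j : Fin N) (f : RatXP N) :
    single 1 f * dunklSum j - dunklSum j * single 1 f =
      ∑ a, single (swap j a) ((x j - x a)⁻¹ * (f - swap j a • f)) := by
  rw [dunklSum, mul_sum, sum_mul, ← sum_sub_distrib]
  refine sum_congr rfl fun a _ => ?_
  rw [single_mul_single, single_mul_single, one_mul, mul_one, one_smul, sub_eq_add_neg,
    ← single_neg, ← single_add, mul_comm f, ← sub_eq_add_neg, mul_sub]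

theorem dunklSum_mul_sub_of_ne {i j : Fin N} (hij : i ≠ j) (f : Fin N → RatXP N)
    (hf : ∀ (σ : Perm (Fin N)) k, σ • f k = f (σ k)) :
    single 1 (f i) * dunklSum j - dunklSum j * single 1 (f i) =
      single (swap j i) ((x j - x i)⁻¹ * (f i - f j)) := by
  rw [dunklSum_mul_sub, sum_eq_single i]
  · rw [hf, swap_apply_right]
  · intro a _ ha
    rw [hf, swap_apply_of_ne_of_ne hij ha.symm, sub_self, mul_zero, single_zero]
  · simp

theorem x_mul_dunklSum_sub_of_ne {i j : Fin N} (hij : i ≠ j) :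
    single 1 (x i) * dunklSum j - dunklSum j * single 1 (x i) = -single (swap i j) 1 := by
  rw [dunklSum_mul_sub_of_ne hij x smul_x, swap_comm, ← single_neg, ← neg_sub (x j) (x i), mul_neg,
    inv_mul_cancel₀ (x_sub_x_ne_zero hij.symm)]

theorem x_mul_dunklSum_sub (i : Fin N) :
    single 1 (x i) * dunklSum i - dunklSum i * single 1 (x i) =
      ∑ a ∈ univ.erase i, single (swap i a) 1 := by
  rw [dunklSum_mul_sub, ← sum_erase (s := univ) (a := i) (h := by simp)]
  refine sum_congr rfl fun a ha => ?_
  rw [smul_x, swap_apply_left, inv_mul_cancel₀ (x_sub_x_ne_zero (ne_of_mem_erase ha).symm)]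

theorem dunklSum_mul_coeff_one {i j : Fin N} (hij : i ≠ j) :
    (dunklSum i * dunklSum j).coeff 1 = (x i - x j)⁻¹ * (x i - x j)⁻¹ := by
  have h : ∀ a, (single (swap i a) (x i - x a)⁻¹ * dunklSum j).coeff 1 =
      (x i - x a)⁻¹ * swap i a • (dunklSum j).coeff (swap i a) := by
    intro a
    rw [coeff_single_mul, mul_one, swap_inv]
  conv_lhs => rw [dunklSum, sum_mul, ← coeffAddEquiv_apply, map_sum, Finsupp.finsetSum_apply]
  simp only [coeffAddEquiv_apply, h, coeff_dunklSum]
  rw [sum_eq_single j]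
  · rw [swap_apply_right, if_pos (swap_comm j i), smul_inv'', smul_sub, smul_x, smul_x,
      swap_apply_left, swap_apply_right]
  · intro a _ ha
    by_cases hai : a = i
    · subst hai; simp
    · rw [swap_apply_of_ne_of_ne hij.symm ha.symm, swap_self, if_neg, smul_zero, mul_zero]
      intro e
      have := congrArg (fun τ : Perm (Fin N) => τ i) e
      simp only [refl_apply, swap_apply_left] at this
      exact hai this.symm
  · simp

/-- The commutator with `x_k` shows that the commutator of two Dunkl sums is a rational function,
which is then found by comparing coefficients of the identity. -/
theorem dunklSum_commute (i j : Fin N) : Commute (dunklSum i) (dunklSum j) := by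
  by_cases hij : i = j
  · subst hij; exact Commute.refl _
  have jac : ∀ a b z : SkewXP N, (a * b - b * a) * z - z * (a * b - b * a) =
      (b * (z * a - a * z) - (z * a - a * z) * b) -
        (a * (z * b - b * z) - (z * b - b * z) * a) := by
    intro a b z; noncomm_ring
  have hs : ∀ {g : Perm (Fin N)} {k : Fin N}, g k = k →
      dunklSum k * single g 1 - single g 1 * dunklSum k = 0 := by
    intro g k h; rw [perm_mul_dunklSum, h, sub_self]
  have hx : ∀ i j k : Fin N, i ≠ j → k ≠ j →
      (dunklSum i * dunklSum j - dunklSum j * dunklSum i) * single 1 (x k) -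
        single 1 (x k) * (dunklSum i * dunklSum j - dunklSum j * dunklSum i) = 0 := by
    intro i j k hij hkj
    rw [jac, x_mul_dunklSum_sub_of_ne hkj]
    by_cases hki : k = i
    · subst hki
      rw [x_mul_dunklSum_sub, mul_sum, sum_mul, ← sum_sub_distrib, sum_eq_single j]
      · rw [perm_mul_dunklSum, swap_apply_right, mul_neg, neg_mul, perm_mul_dunklSum,
          swap_apply_left]
        abel
      · intro a ha haj
        exact hs (swap_apply_of_ne_of_ne hij.symm haj.symm)
      · intro h
        exact absurd (mem_erase.2 ⟨hij.symm, mem_univ _⟩) h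
    · rw [x_mul_dunklSum_sub_of_ne hki, mul_neg, neg_mul, mul_neg, neg_mul, ← neg_sub', ← neg_sub',
        hs (swap_apply_of_ne_of_ne hkj.symm hij.symm), hs (swap_apply_of_ne_of_ne (Ne.symm hki) hij)]
      simp
  have hcomm : ∀ k, Commute (dunklSum i * dunklSum j - dunklSum j * dunklSum i)
      (single 1 (x k)) := by
    intro k
    rw [commute_iff_eq, ← sub_eq_zero]
    by_cases hkj : k = j
    · subst hkj
      have := hx k i k (Ne.symm hij) (Ne.symm hij)
      rw [← neg_sub (dunklSum k * dunklSum i), neg_mul, mul_neg, ← neg_sub', this, neg_zero]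
    · exact hx i j k hij hkj
  have h1 := eq_single_one_of_commute hcomm
  rw [SkewMonoidAlgebra.coeff_sub, Finsupp.sub_apply, dunklSum_mul_coeff_one hij,
    dunklSum_mul_coeff_one (Ne.symm hij), ← neg_sub (x i) (x j), inv_neg, neg_mul_neg, sub_self,
    single_zero] at h1
  rw [commute_iff_eq]
  exact sub_eq_zero.1 h1

theorem commute_single_one (f g : RatXP N) :
    Commute (single 1 f : SkewXP N) (single 1 g) := by
  rw [commute_iff_eq, single_mul_single, single_mul_single, one_smul, one_smul, mul_comm f]

theorem perm_mul_single_one (g : Perm (Fin N)) (f : RatXP N) :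
    (single g 1 * single 1 f : SkewXP N) = single 1 (g • f) * single g 1 := by
  rw [single_mul_single, single_mul_single, one_smul, mul_one, one_mul, mul_one, one_mul]

theorem X_mul_C_sub_C_mul {R : Type*} [Ring R] (a b c d : R) :
    (X * C a - C b) * (X * C c - C d) =
      X * X * C (a * c) - X * C (a * d + b * c) + C (b * d) := by
  have h : C b * X = X * C b := (X_mul_C b).symm
  have h' : C a * X = X * C a := (X_mul_C a).symm
  have e1 : C b * (X * C c) = X * C (b * c) := by rw [← mul_assoc, h, mul_assoc, ← C_mul]
  have e2 : X * C a * (X * C c) = X * X * C (a * c) := by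
    rw [mul_assoc, ← mul_assoc (C a), h', C_mul]; simp only [mul_assoc]
  rw [sub_mul, mul_sub, mul_sub, e1, e2, mul_assoc X (C a), ← C_mul, ← C_mul, C_add, mul_add]
  abel

/-- The Dunkl operators `t p_i - ∑_{a ≠ i} (x_i - x_a)⁻¹ s_{ia}` over the skew group algebra. The
central variable `t` keeps track of the degree in the `p_i`. -/
noncomputable def dunklSystem (N : ℕ) : CherednikSystem N (SkewXP N)[X] where
  perm := ((C : SkewXP N →+* (SkewXP N)[X]) : SkewXP N →* (SkewXP N)[X]).comp (of _ _)
  x i := C (single 1 (x i))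
  y i := X * C (single 1 (p i)) - C (dunklSum i)
  x_comm i j := by rw [commute_iff_eq, ← C_mul, ← C_mul, (commute_single_one _ _).eq]
  y_comm i j := by
    by_cases hij : i = j
    · subst hij; exact Commute.refl _
    have e := (dunklSum_mul_sub_of_ne hij p smul_p)
    have e' := (dunklSum_mul_sub_of_ne (Ne.symm hij) p smul_p)
    rw [swap_comm, ← neg_sub (x j) (x i), inv_neg, neg_mul, ← mul_neg, neg_sub, ← e] at e'
    have e2 : single 1 (p i) * dunklSum j + dunklSum i * single 1 (p j) =
        single 1 (p j) * dunklSum i + dunklSum j * single 1 (p i) := by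
      rw [sub_eq_sub_iff_add_eq_add] at e'
      rw [← e', add_comm]
    rw [commute_iff_eq, X_mul_C_sub_C_mul, X_mul_C_sub_C_mul, (commute_single_one _ _).eq,
      (dunklSum_commute i j).eq, e2]
  perm_mul_x g i := by
    change C (of _ _ g) * C _ = C _ * C (of _ _ g)
    rw [of_apply, ← C_mul, ← C_mul, perm_mul_single_one, smul_x]
  perm_mul_y g i := by
    change C (of _ _ g) * _ = _ * C (of _ _ g)
    rw [of_apply, mul_sub, sub_mul, ← mul_assoc, ← X_mul_C, mul_assoc, mul_assoc, ← C_mul, ← C_mul,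
      ← C_mul, ← C_mul, perm_mul_single_one, smul_p, perm_mul_dunklSum]
  x_mul_y i j h := by
    change _ = _ + C (of _ _ _)
    have e := x_mul_dunklSum_sub_of_ne h
    rw [sub_eq_iff_eq_add] at e
    rw [of_apply, mul_sub, sub_mul, ← mul_assoc, ← X_mul_C, mul_assoc, mul_assoc, ← C_mul, ← C_mul,
      ← C_mul, ← C_mul, e, (commute_single_one _ _).eq, C_add, C_neg]
    abel
  x_mul_y_self i := by
    change _ = _ - ∑ a ∈ univ.erase i, C (of _ _ _)
    have e := x_mul_dunklSum_sub i
    rw [sub_eq_iff_eq_add] at e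
    rw [← map_sum, mul_sub, sub_mul, ← mul_assoc, ← X_mul_C, mul_assoc, mul_assoc, ← C_mul,
      ← C_mul, ← C_mul, ← C_mul, e, (commute_single_one _ _).eq, C_add]
    simp only [of_apply]
    abel

end Dunkl

/-! ### The Dunkl representation -/

/-- A Cherednik system in a complex algebra is the image of the generators under a homomorphism. -/
theorem CherednikSystem.exists_lift {N : ℕ} {Q : Type*} [Ring Q] [Algebra ℂ Q]
    (D : CherednikSystem N Q) : ∃ φ : H N →ₐ[ℂ] Q,
      (∀ i, φ (hx i) = D.x i) ∧ (∀ i, φ (hy i) = D.y i) ∧ ∀ σ, φ (permH N σ) = D.perm σ := by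
  let g : Gen N → Q := fun a => match a with
    | Gen.x i => D.x i
    | Gen.y i => D.y i
    | Gen.s j k _ => D.perm (swap j k)
  have hrel : ∀ ⦃a b : FreeAlgebra ℂ (Gen N)⦄, Rel N a b →
      FreeAlgebra.lift ℂ g a = FreeAlgebra.lift ℂ g b := by
    intro a b hab
    cases hab with
    | s_symm i j h => simp [g, swap_comm]
    | s_sq i j h =>
      simp only [map_mul, map_one, FreeAlgebra.lift_ι_apply, g]
      rw [← map_mul, swap_mul_self, map_one]
    | s_mul_s i j k hij hjk hik =>
      simp only [map_mul, FreeAlgebra.lift_ι_apply, g]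
      rw [← map_mul, ← map_mul, mul_swap_eq_swap_mul, swap_apply_right,
        swap_apply_of_ne_of_ne hik.symm hjk.symm]
    | s_comm i j k l hij hik hil hjk hjl hkl =>
      simp only [map_mul, FreeAlgebra.lift_ι_apply, g]
      rw [← map_mul, ← map_mul, mul_swap_eq_swap_mul,
        swap_apply_of_ne_of_ne hik.symm hjk.symm, swap_apply_of_ne_of_ne hil.symm hjl.symm]
    | x_comm i j h => simp [g, (D.x_comm i j).eq]
    | y_comm i j h => simp [g, (D.y_comm i j).eq]
    | s_mul_x i j h => simp [g, D.perm_mul_x]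
    | s_mul_y i j h => simp [g, D.perm_mul_y]
    | s_comm_x i j k hij hik hjk =>
      simp [g, D.perm_mul_x, swap_apply_of_ne_of_ne hik.symm hjk.symm]
    | s_comm_y i j k hij hik hjk =>
      simp [g, D.perm_mul_y, swap_apply_of_ne_of_ne hik.symm hjk.symm]
    | x_y i j h => simp [g, D.x_mul_y i j h]
    | x_y_self i =>
      have : ∑ a ∈ univ.erase i, D.perm (swap i a) =
          ∑ a : {a : Fin N // a ≠ i}, D.perm (swap i a.1) :=
        sum_subtype (univ.erase i) (p := fun a => a ≠ i) (by simp) _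
      simp [g, D.x_mul_y_self i, this]
  obtain ⟨φ, hφ⟩ := exists_lift_mk (FreeAlgebra.lift ℂ g) hrel
  have hφx : ∀ i, φ (hx i) = D.x i := fun i => (hφ _).trans (FreeAlgebra.lift_ι_apply _ _)
  have hφy : ∀ i, φ (hy i) = D.y i := fun i => (hφ _).trans (FreeAlgebra.lift_ι_apply _ _)
  refine ⟨φ, hφx, hφy, fun σ => ?_⟩
  induction σ using Perm.swap_induction_on with
  | one => rw [map_one, map_one, map_one]
  | swap_mul g a b hab ih =>
    rw [map_mul, map_mul, map_mul, ih, permH_swap a b hab, hs, hφ, FreeAlgebra.lift_ι_apply]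

/-- The Dunkl representation of `H_N` over the skew group algebra. -/
noncomputable def dunkl (N : ℕ) : H N →ₐ[ℂ] (SkewXP N)[X] := (dunklSystem N).exists_lift.choose

section

variable {N : ℕ}

theorem dunkl_hx (i : Fin N) : dunkl N (hx i) = C (single 1 (x i)) :=
  (dunklSystem N).exists_lift.choose_spec.1 i

theorem dunkl_hy (i : Fin N) :
    dunkl N (hy i) = X * C (single 1 (p i)) - C (dunklSum i) :=
  (dunklSystem N).exists_lift.choose_spec.2.1 i

theorem dunkl_permH (σ : Perm (Fin N)) : dunkl N (permH N σ) = C (single σ 1) :=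
  ((dunklSystem N).exists_lift.choose_spec.2.2 σ).trans (congrArg C (of_apply _ _ _))

/-! ### Symbols -/

/-- The polynomial `z` has degree at most `d`, and `b` is its coefficient in degree `d`; the
coefficient `b` may vanish. -/
def HasSymbol {R : Type*} [Ring R] (d : ℕ) (z : R[X]) (b : R) : Prop :=
  z.natDegree ≤ d ∧ z.coeff d = b

namespace HasSymbol

variable {R : Type*} [Ring R] {d e : ℕ} {z w : R[X]} {a b : R}

theorem zero (d : ℕ) : HasSymbol d (0 : R[X]) 0 := ⟨by simp, by simp⟩

theorem C (b : R) : HasSymbol 0 (C b) b := ⟨by simp, by simp⟩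

theorem add (hz : HasSymbol d z a) (hw : HasSymbol d w b) : HasSymbol d (z + w) (a + b) :=
  ⟨natDegree_add_le_of_degree_le hz.1 hw.1, by rw [coeff_add, hz.2, hw.2]⟩

theorem neg (hz : HasSymbol d z a) : HasSymbol d (-z) (-a) :=
  ⟨by rw [natDegree_neg]; exact hz.1, by rw [coeff_neg, hz.2]⟩

theorem sub (hz : HasSymbol d z a) (hw : HasSymbol d w b) : HasSymbol d (z - w) (a - b) := by
  rw [sub_eq_add_neg, sub_eq_add_neg]; exact hz.add hw.neg

theorem mul (hz : HasSymbol d z a) (hw : HasSymbol e w b) : HasSymbol (d + e) (z * w) (a * b) :=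
  ⟨natDegree_mul_le_of_le hz.1 hw.1,
    by rw [coeff_mul_add_eq_of_natDegree_le hz.1 hw.1, hz.2, hw.2]⟩

theorem pow (hz : HasSymbol d z a) (n : ℕ) : HasSymbol (n * d) (z ^ n) (a ^ n) := by
  induction n with
  | zero => simpa using HasSymbol.C (1 : R)
  | succ n ih => rw [pow_succ, pow_succ, add_mul, one_mul]; exact ih.mul hz

theorem sum {ι : Type*} {s : Finset ι} {z : ι → R[X]} {b : ι → R}
    (h : ∀ i ∈ s, HasSymbol d (z i) (b i)) : HasSymbol d (∑ i ∈ s, z i) (∑ i ∈ s, b i) := by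
  classical
  induction s using Finset.induction_on with
  | empty => simpa using HasSymbol.zero d
  | insert i s hi ih =>
    rw [sum_insert hi, sum_insert hi]
    exact (h i (mem_insert_self _ _)).add (ih fun j hj => h j (mem_insert_of_mem hj))

theorem smul {S : Type*} [CommSemiring S] [Algebra S R] (r : S) (hz : HasSymbol d z a) :
    HasSymbol d (r • z) (r • a) :=
  ⟨(natDegree_smul_le r z).trans hz.1, by rw [coeff_smul, hz.2]⟩

theorem zsmul (n : ℤ) (hz : HasSymbol d z a) : HasSymbol d (n • z) (n • a) :=
  ⟨(natDegree_smul_le n z).trans hz.1, by rw [coeff_smul, hz.2]⟩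

theorem of_lt (hz : HasSymbol d z a) (h : d < e) : HasSymbol e z 0 :=
  ⟨hz.1.trans h.le, coeff_eq_zero_of_natDegree_lt (hz.1.trans_lt h)⟩

end HasSymbol

theorem algebraMap_skew (a : ℂ) :
    algebraMap ℂ (SkewXP N)[X] a = C (single 1 (ofPoly N (MvPolynomial.C a))) := by
  rw [Polynomial.algebraMap_apply]
  congr 1

theorem dunkl_polyX (f : MvPolynomial (Fin N) ℂ) :
    dunkl N (polyX N f) = C (single 1 (ofPoly N (MvPolynomial.rename Sum.inl f))) := by
  induction f using MvPolynomial.induction_on with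
  | C a =>
    rw [MvPolynomial.rename_C, ← algebraMap_skew, ← MvPolynomial.algebraMap_eq, AlgHom.commutes,
      AlgHom.commutes]
  | add p q hp hq => rw [map_add, map_add, hp, hq, map_add, map_add, single_add, C_add]
  | mul_X q i hq =>
    rw [map_mul, map_mul, hq, polyX_X, dunkl_hx, ← C_mul, single_mul_single, one_mul, one_smul,
      map_mul, map_mul, MvPolynomial.rename_X, x]

theorem hasSymbol_hy (i : Fin N) : HasSymbol 1 (dunkl N (hy i)) (single 1 (p i)) := by
  rw [dunkl_hy]
  refine ⟨(natDegree_sub_le _ _).trans (max_le ?_ ?_), ?_⟩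
  · rw [X_mul_C]
    exact (natDegree_C_mul_le _ _).trans natDegree_X_le
  · rw [natDegree_C]
    exact zero_le_one
  · rw [X_mul_C, Polynomial.coeff_sub, coeff_C_mul, coeff_X_one, mul_one, coeff_C_succ, sub_zero]

theorem single_one_pow (f : RatXP N) (n : ℕ) :
    (single 1 f : SkewXP N) ^ n = single 1 (f ^ n) := by
  induction n with
  | zero => rfl
  | succ n ih => rw [pow_succ, ih, single_mul_single, one_mul, one_smul, pow_succ]

theorem hasSymbol_polyY_monomial (m : Fin N →₀ ℕ) :
    HasSymbol m.degree (dunkl N (polyY N (MvPolynomial.monomial m 1)))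
      (single 1 (ofPoly N (MvPolynomial.rename Sum.inr (MvPolynomial.monomial m 1)))) := by
  induction m using Finsupp.induction_linear with
  | zero =>
    have : MvPolynomial.monomial (0 : Fin N →₀ ℕ) (1 : ℂ) = 1 := rfl
    simp only [this, map_one]
    exact HasSymbol.C 1
  | add m n hm hn =>
    have : MvPolynomial.monomial (m + n) (1 : ℂ) =
        MvPolynomial.monomial m 1 * MvPolynomial.monomial n 1 := by
      rw [MvPolynomial.monomial_mul, one_mul]
    have h2 := hm.mul hn
    rw [single_mul_single, one_mul, one_smul, ← map_mul, ← map_mul, ← map_mul, ← map_mul,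
      ← this] at h2
    rwa [map_add]
  | single i k =>
    have : MvPolynomial.monomial (Finsupp.single i k) (1 : ℂ) = MvPolynomial.X i ^ k :=
      (MvPolynomial.X_pow_eq_monomial).symm
    have h2 := (hasSymbol_hy i).pow k
    rw [single_one_pow, mul_one] at h2
    rw [this, map_pow, map_pow, map_pow, map_pow, polyY_X, MvPolynomial.rename_X,
      Finsupp.degree_single]
    exact h2

theorem smul_single_one (r : ℂ) (f : RatXP N) :
    r • (single 1 f : SkewXP N) = single 1 (r • f) := SkewMonoidAlgebra.smul_single _ _ _

theorem single_sum {ι : Type*} (s : Finset ι) (σ : Perm (Fin N)) (f : ι → RatXP N) :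
    (single σ (∑ i ∈ s, f i) : SkewXP N) = ∑ i ∈ s, single σ (f i) :=
  map_sum (SkewMonoidAlgebra.singleAddHom σ) f s

theorem hasSymbol_polyY {g : MvPolynomial (Fin N) ℂ} {d : ℕ} (hg : g.IsHomogeneous d) :
    HasSymbol d (dunkl N (polyY N g))
      (single 1 (ofPoly N (MvPolynomial.rename Sum.inr g))) := by
  rw [g.as_sum]
  simp only [map_sum, single_sum]
  refine HasSymbol.sum fun m hm => ?_
  have e : MvPolynomial.monomial m (g.coeff m) =
      g.coeff m • MvPolynomial.monomial m (1 : ℂ) := by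
    rw [MvPolynomial.smul_monomial, smul_eq_mul, mul_one]
  have hd : m.degree = d := by
    rw [← hg (MvPolynomial.mem_support_iff.1 hm), Finsupp.degree_eq_weight_one]
    rfl
  rw [e]
  simp only [map_smul, ← smul_single_one]
  rw [← hd]
  exact (hasSymbol_polyY_monomial m).smul _

/-- The degree of a monomial in the `p_i`. -/
noncomputable def pDegree (m : Fin N ⊕ Fin N →₀ ℕ) : ℕ := (splitExp m).2.degree

theorem hasSymbol_normalOrder_monomial (m : Fin N ⊕ Fin N →₀ ℕ) :
    HasSymbol (pDegree m) (dunkl N (normalOrder N (MvPolynomial.monomial m 1)))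
      (single 1 (ofPoly N (MvPolynomial.monomial m 1))) := by
  have h := (HasSymbol.C (single 1 (ofPoly N (MvPolynomial.rename Sum.inl
    (MvPolynomial.monomial (splitExp m).1 1))))).mul (hasSymbol_polyY_monomial (splitExp m).2)
  rw [normalOrder_monomial_one, map_mul, dunkl_polyX]
  rw [single_mul_single, one_mul, one_smul, ← map_mul, monomial_splitExp, one_mul, zero_add] at h
  exact h

/-- The part of a polynomial of degree `d` in the `p_i`. -/
noncomputable def pPart (d : ℕ) (q : XY N) : XY N :=
  ∑ m ∈ q.support, if pDegree m = d then MvPolynomial.monomial m (q.coeff m) else 0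

theorem coeff_pPart (d : ℕ) (q : XY N) (m : Fin N ⊕ Fin N →₀ ℕ) :
    (pPart d q).coeff m = if pDegree m = d then q.coeff m else 0 := by
  classical
  rw [pPart, MvPolynomial.coeff_sum, sum_eq_single m]
  · split_ifs <;> simp
  · intro n _ hn
    split_ifs
    · rw [MvPolynomial.coeff_monomial, if_neg hn]
    · simp
  · intro hm
    rw [MvPolynomial.notMem_support_iff.1 hm]
    simp

theorem hasSymbol_normalOrder {q : XY N} {d : ℕ} (hq : ∀ m ∈ q.support, pDegree m ≤ d) :
    HasSymbol d (dunkl N (normalOrder N q)) (single 1 (ofPoly N (pPart d q))) := by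
  conv in normalOrder N q => rw [q.as_sum]
  rw [pPart]
  simp only [map_sum, single_sum]
  refine HasSymbol.sum fun m hm => ?_
  have e : MvPolynomial.monomial m (q.coeff m) =
      q.coeff m • MvPolynomial.monomial m (1 : ℂ) := by
    rw [MvPolynomial.smul_monomial, smul_eq_mul, mul_one]
  have h := (hasSymbol_normalOrder_monomial m).smul (q.coeff m)
  rw [e, map_smul, map_smul]
  split_ifs with hd
  · rw [← hd, map_smul, ← smul_single_one]
    exact h
  · rw [map_zero, single_zero]
    exact h.of_lt (lt_of_le_of_ne (hq m hm) hd)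

theorem hasSymbol_sum_normalOrder {q : Perm (Fin N) → XY N} {d : ℕ}
    (hq : ∀ σ, ∀ m ∈ (q σ).support, pDegree m ≤ d) :
    HasSymbol d (dunkl N (∑ σ, normalOrder N (q σ) * permH N σ))
      (∑ σ, single σ (ofPoly N (pPart d (q σ)))) := by
  rw [map_sum]
  refine HasSymbol.sum fun σ _ => ?_
  have h := (hasSymbol_normalOrder (hq σ)).mul (HasSymbol.C (single σ 1))
  rw [single_mul_single, one_mul, one_smul, mul_one, add_zero] at h
  rwa [map_mul, dunkl_permH]

theorem coeff_sum_single (f : Perm (Fin N) → RatXP N) (τ : Perm (Fin N)) :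
    (∑ σ, single σ (f σ) : SkewXP N).coeff τ = f τ := by
  classical
  rw [← coeffAddEquiv_apply, map_sum, Finsupp.finsetSum_apply, sum_eq_single τ]
  · rw [coeffAddEquiv_apply, coeff_single, Finsupp.single_eq_same]
  · intro σ _ h
    rw [coeffAddEquiv_apply, coeff_single, Finsupp.single_apply, if_neg h]
  · simp

theorem pPart_eq_zero_of_sum_eq_zero {q : Perm (Fin N) → XY N} {d : ℕ}
    (h : (∑ σ, single σ (ofPoly N (pPart d (q σ))) : SkewXP N) = 0) (σ : Perm (Fin N)) :
    pPart d (q σ) = 0 := by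
  have := coeff_sum_single (fun σ => ofPoly N (pPart d (q σ))) σ
  rw [h] at this
  exact ofPoly_injective (this.symm.trans (map_zero _).symm)

/-- The degree in the `y_i` of a normally ordered expression does not exceed the degree of its image
under the Dunkl representation, since leading terms do not cancel. -/
theorem pDegree_le_of_natDegree_le {q : Perm (Fin N) → XY N} {d : ℕ}
    (h : (dunkl N (∑ σ, normalOrder N (q σ) * permH N σ)).natDegree ≤ d) (D : ℕ)
    (hD : ∀ σ, ∀ m ∈ (q σ).support, pDegree m ≤ D) :
    ∀ σ, ∀ m ∈ (q σ).support, pDegree m ≤ d := by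
  induction D with
  | zero => exact fun σ m hm => (hD σ m hm).trans (Nat.zero_le _)
  | succ D ih =>
    by_cases hd : D + 1 ≤ d
    · exact fun σ m hm => (hD σ m hm).trans hd
    · refine ih fun σ m hm => ?_
      have h1 := (hasSymbol_sum_normalOrder hD).2
      rw [coeff_eq_zero_of_natDegree_lt (by omega)] at h1
      have h2 := congrArg (MvPolynomial.coeff m) (pPart_eq_zero_of_sum_eq_zero h1.symm σ)
      rw [coeff_pPart, MvPolynomial.coeff_zero] at h2
      have h3 := MvPolynomial.mem_support_iff.1 hm
      have h4 := hD σ m hm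
      split_ifs at h2 with h5
      · exact absurd h2 h3
      · omega

theorem exists_pDegree_bound (q : Perm (Fin N) → XY N) :
    ∃ D, ∀ σ, ∀ m ∈ (q σ).support, pDegree m ≤ D :=
  ⟨univ.sup fun σ => (q σ).support.sup pDegree, fun σ _ hm =>
    (le_sup (f := pDegree) hm).trans (le_sup (f := fun σ => (q σ).support.sup pDegree)
      (mem_univ σ))⟩

theorem exists_symbol {z : H N} {d : ℕ} (h : (dunkl N z).natDegree ≤ d) :
    ∃ q : Perm (Fin N) → XY N, (∀ σ, ∀ m ∈ (q σ).support, pDegree m = d) ∧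
      (dunkl N z).coeff d = ∑ σ, single σ (ofPoly N (q σ)) := by
  obtain ⟨q, rfl⟩ := exists_eq_sum_normalOrder z
  obtain ⟨D, hD⟩ := exists_pDegree_bound q
  refine ⟨fun σ => pPart d (q σ), fun σ m hm => ?_,
    (hasSymbol_sum_normalOrder (pDegree_le_of_natDegree_le h D hD)).2⟩
  rw [MvPolynomial.mem_support_iff, coeff_pPart] at hm
  exact (ite_ne_right_iff.1 hm).1

/-- The Dunkl representation is faithful. -/
theorem dunkl_injective : Function.Injective (dunkl N) := by
  rw [injective_iff_map_eq_zero]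
  intro z hz
  obtain ⟨q, rfl⟩ := exists_eq_sum_normalOrder z
  obtain ⟨D, hD⟩ := exists_pDegree_bound q
  have h0 := pDegree_le_of_natDegree_le (d := 0) (by rw [hz, natDegree_zero]) D hD
  have h1 := (hasSymbol_sum_normalOrder h0).2
  rw [hz, coeff_zero] at h1
  have h2 : ∀ σ, q σ = 0 := by
    intro σ
    ext m
    have h := congrArg (MvPolynomial.coeff m) (pPart_eq_zero_of_sum_eq_zero h1.symm σ)
    rw [coeff_pPart] at h
    split_ifs at h with h3
    · exact h
    · by_contra h4
      exact h3 (Nat.le_zero.1 (h0 σ m (MvPolynomial.mem_support_iff.2 h4)))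
  simp [h2]

/-! ### The center -/

theorem commute_coeff_of_commute_C {R : Type*} [Ring R] {z : R[X]} {b : R} (h : Commute z (C b))
    (n : ℕ) : Commute (z.coeff n) b := by
  have := congrArg (fun w => w.coeff n) h.eq
  simp only [coeff_mul_C, coeff_C_mul] at this
  exact this

theorem commute_C_of_commute_coeff {R : Type*} [Ring R] {z : R[X]} {b : R}
    (h : ∀ n, Commute (z.coeff n) b) : Commute z (C b) := by
  rw [commute_iff_eq]
  ext n
  rw [coeff_mul_C, coeff_C_mul, (h n).eq]

theorem smul_eq_of_commute {f : RatXP N} {g : Perm (Fin N)}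
    (h : Commute (single 1 f : SkewXP N) (single g 1)) : g • f = f := by
  rw [commute_iff_eq, single_mul_single, single_mul_single, one_mul, mul_one, smul_one, mul_one,
    one_mul] at h
  exact (SkewMonoidAlgebra.single_injective g h).symm

theorem coeff_dunkl_eq_of_commute {z : H N} (hX : ∀ i, Commute z (hx i))
    (hP : ∀ σ, Commute z (permH N σ)) (n : ℕ) :
    ∃ f : RatXP N, (dunkl N z).coeff n = single 1 f ∧ ∀ σ : Perm (Fin N), σ • f = f := by
  have h1 : ∀ k, Commute ((dunkl N z).coeff n) (single 1 (x k)) := fun k =>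
    commute_coeff_of_commute_C (by rw [← dunkl_hx]; exact (hX k).map _) n
  have h2 := eq_single_one_of_commute h1
  refine ⟨_, h2, fun σ => smul_eq_of_commute ?_⟩
  rw [← h2]
  exact commute_coeff_of_commute_C (by rw [← dunkl_permH]; exact (hP σ).map _) n

/-- Commutation with the `y_i` is automatic: the coefficients of the image under the Dunkl
representation are invariant rational functions, and these commute with the Dunkl operators. -/
theorem mem_center_of_commute_hx_permH {z : H N} (hX : ∀ i, Commute z (hx i))
    (hP : ∀ σ, Commute z (permH N σ)) : z ∈ Subalgebra.center ℂ (H N) := by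
  refine mem_center_of_commute hX (fun i => ?_) hP
  have h1 : Commute (dunkl N z) (C (single 1 (p i))) := by
    refine commute_C_of_commute_coeff fun n => ?_
    obtain ⟨f, hf, -⟩ := coeff_dunkl_eq_of_commute hX hP n
    rw [hf]
    exact commute_single_one _ _
  have h2 : Commute (dunkl N z) (C (dunklSum i)) := by
    refine commute_C_of_commute_coeff fun n => ?_
    obtain ⟨f, hf, hinv⟩ := coeff_dunkl_eq_of_commute hX hP n
    rw [hf, dunklSum]
    refine Commute.sum_right _ _ _ fun a _ => ?_
    rw [commute_iff_eq, single_mul_single, single_mul_single, hinv, one_mul, mul_one, one_smul,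
      mul_comm f]
  have h3 : Commute (dunkl N z) (dunkl N (hy i)) := by
    rw [dunkl_hy]
    exact ((commute_X _).symm.mul_right h1).sub_right h2
  rw [commute_iff_eq, ← map_mul, ← map_mul] at h3
  exact dunkl_injective h3

theorem c_mem_center (i j : Fin (N + 1)) : c i j ∈ Subalgebra.center ℂ (H N) :=
  mem_center_of_commute_hx_permH (commute_c_hx i j) (commute_c_permH i j)

/-- The symbol of a central element is an invariant polynomial. -/
theorem exists_symbol_of_mem_center {z : H N} (hz : z ∈ Subalgebra.center ℂ (H N)) {d : ℕ}
    (h : (dunkl N z).natDegree ≤ d) :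
    ∃ q : XY N, (∀ m ∈ q.support, pDegree m = d) ∧ (∀ σ : Perm (Fin N), σ • q = q) ∧
      (dunkl N z).coeff d = single 1 (ofPoly N q) := by
  have hc : ∀ b, Commute z b := fun b => (Subalgebra.mem_center_iff.1 hz b).symm
  obtain ⟨q, hq, hq'⟩ := exists_symbol h
  obtain ⟨f, hf, hinv⟩ := coeff_dunkl_eq_of_commute (fun i => hc (hx i)) (fun σ => hc (permH N σ)) d
  have h1 := coeff_sum_single (fun σ => ofPoly N (q σ)) 1
  rw [← hq', hf, coeff_single, Finsupp.single_eq_same] at h1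
  subst h1
  refine ⟨q 1, hq 1, fun σ => ofPoly_injective ?_, hf⟩
  rw [← smul_ofPoly, hinv]

end

section

variable {N : ℕ}

/-! ### Symbols of the coefficients of the universal central polynomial -/

theorem rootPoly_monic (J : Finset (Fin N)) : (rootPoly J).Monic :=
  monic_prod_X_sub_C _ _

theorem natDegree_rootPoly (J : Finset (Fin N)) : (rootPoly J).natDegree = #J :=
  natDegree_finsetProd_X_sub_C_eq_card _ _

theorem coeff_rootPoly_card (J : Finset (Fin N)) : (rootPoly J).coeff #J = 1 := by
  rw [← natDegree_rootPoly]; exact rootPoly_monic J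

theorem coeff_rootPoly_of_lt {J : Finset (Fin N)} {b : ℕ} (h : #J < b) :
    (rootPoly J).coeff b = 0 :=
  coeff_eq_zero_of_natDegree_lt (by rwa [natDegree_rootPoly])

theorem coeff_X_sub_C_mul_succ {R : Type*} [Ring R] (r : R) (q : R[X]) (n : ℕ) :
    ((X - C r) * q).coeff (n + 1) = q.coeff n - r * q.coeff (n + 1) := by
  rw [sub_mul, Polynomial.coeff_sub, coeff_X_mul, coeff_C_mul]

theorem coeff_X_sub_C_mul_zero {R : Type*} [Ring R] (r : R) (q : R[X]) :
    ((X - C r) * q).coeff 0 = -(r * q.coeff 0) := by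
  rw [sub_mul, Polynomial.coeff_sub, coeff_X_mul_zero, coeff_C_mul, zero_sub]

theorem isHomogeneous_coeff_rootPoly (J : Finset (Fin N)) :
    ∀ b n, b + n = #J → ((rootPoly J).coeff b).IsHomogeneous n := by
  induction J using Finset.induction_on with
  | empty =>
    intro b n h
    obtain ⟨rfl, rfl⟩ : b = 0 ∧ n = 0 := by simpa using h
    simpa [rootPoly] using MvPolynomial.isHomogeneous_one (Fin N) ℂ
  | insert a J ha ih =>
    intro b n h
    rw [card_insert_of_notMem ha] at h
    have e : rootPoly (insert a J) = (X - C (MvPolynomial.X a)) * rootPoly J := by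
      rw [rootPoly, prod_insert ha, rootPoly]
    have hX := MvPolynomial.isHomogeneous_X ℂ a
    rw [e]
    cases b with
    | zero =>
      rw [coeff_X_sub_C_mul_zero]
      have hn : n = 1 + #J := by omega
      rw [hn]
      exact (hX.mul (ih 0 _ (zero_add _))).neg
    | succ b =>
      rw [coeff_X_sub_C_mul_succ]
      refine (ih b n (by omega)).sub ?_
      cases n with
      | zero =>
        rw [coeff_rootPoly_of_lt (by omega), mul_zero]
        exact MvPolynomial.isHomogeneous_zero _ _ _
      | succ n =>
        rw [add_comm n 1]
        exact hX.mul (ih _ _ (by omega))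

/-- Polynomials in the `x_i` as rational functions. -/
noncomputable def inX (N : ℕ) : MvPolynomial (Fin N) ℂ →ₐ[ℂ] RatXP N :=
  (ofPoly N).comp (MvPolynomial.rename Sum.inl)

/-- Polynomials in the `p_i` as rational functions. -/
noncomputable def inP (N : ℕ) : MvPolynomial (Fin N) ℂ →ₐ[ℂ] RatXP N :=
  (ofPoly N).comp (MvPolynomial.rename Sum.inr)

theorem inX_X (i : Fin N) : inX N (MvPolynomial.X i) = x i := by
  rw [inX, AlgHom.comp_apply, MvPolynomial.rename_X, x]

theorem inP_X (i : Fin N) : inP N (MvPolynomial.X i) = p i := by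
  rw [inP, AlgHom.comp_apply, MvPolynomial.rename_X, p]

theorem hasSymbol_polyX (f : MvPolynomial (Fin N) ℂ) :
    HasSymbol 0 (dunkl N (polyX N f)) (single 1 (inX N f)) := by
  rw [dunkl_polyX]; exact HasSymbol.C _

theorem hasSymbol_term {J : Finset (Fin N)} {b n : ℕ} (hb : b + n = #J) (a : ℕ)
    (σ : Perm (Fin N)) :
    HasSymbol n (dunkl N (polyX N ((rootPoly J).coeff a) * polyY N ((rootPoly J).coeff b) *
      permH N σ)) (single σ (inX N ((rootPoly J).coeff a) * inP N ((rootPoly J).coeff b))) := by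
  have h := ((hasSymbol_polyX ((rootPoly J).coeff a)).mul
    (hasSymbol_polyY (isHomogeneous_coeff_rootPoly J b n hb))).mul (HasSymbol.C (single σ 1))
  rw [single_mul_single, single_mul_single, one_mul, one_mul, one_smul, one_smul, mul_one,
    zero_add, add_zero, ← dunkl_permH, ← map_mul, ← map_mul] at h
  exact h

theorem fix_univ : CherednikSystem.fix (univ : Finset (Fin N)) = {1} := by
  ext σ
  rw [CherednikSystem.mem_fix, mem_singleton]
  exact ⟨fun h => Equiv.ext fun i => h i (mem_univ i), by rintro rfl; simp⟩

theorem fix_compl_singleton (i : Fin N) : CherednikSystem.fix ({i}ᶜ : Finset (Fin N)) = {1} := by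
  ext σ
  rw [CherednikSystem.mem_fix, mem_singleton]
  refine ⟨fun h => Equiv.ext fun j => ?_, by rintro rfl; simp⟩
  have h' : ∀ j, j ≠ i → σ j = j := fun j hj => h j (by simpa using hj)
  by_cases hj : j = i
  · subst hj
    by_contra hne
    exact hne (σ.injective (h' _ hne))
  · exact h' j hj

theorem neg_one_pow_mul_eps_univ :
    (-1) ^ N * CherednikSystem.eps (univ : Finset (Fin N)) 1 = 1 := by
  simp [CherednikSystem.eps, ← mul_pow]

theorem neg_one_pow_mul_eps_compl (i : Fin N) :
    (-1) ^ N * CherednikSystem.eps ({i}ᶜ : Finset (Fin N)) 1 = -1 := by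
  obtain ⟨n, rfl⟩ : ∃ n, N = n + 1 := Nat.exists_eq_add_one.2 i.pos
  simp [CherednikSystem.eps, card_compl, pow_succ, ← mul_pow]

/-- The contribution of a set `J` to a coefficient of the universal central polynomial. -/
noncomputable def centralTerm (a b : ℕ) (J : Finset (Fin N)) : H N :=
  ∑ σ ∈ CherednikSystem.fix J, ((-1) ^ N * CherednikSystem.eps J σ) •
    (polyX N ((rootPoly J).coeff a) * polyY N ((rootPoly J).coeff b) * permH N σ)

theorem coeff_centralPoly_eq_add (a b : ℕ) : ((centralPoly N).coeff a).coeff b =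
    polyX N ((rootPoly univ).coeff a) * polyY N ((rootPoly univ).coeff b) +
      ∑ J ∈ univ.erase univ, centralTerm a b J := by
  rw [coeff_centralPoly, ← add_sum_erase _ _ (mem_univ (univ : Finset (Fin N))), fix_univ,
    sum_singleton, neg_one_pow_mul_eps_univ, one_smul, map_one, mul_one]
  rfl

theorem card_lt_of_mem_erase_univ {J : Finset (Fin N)} (h : J ∈ univ.erase univ) : #J < N := by
  have := card_lt_card (ssubset_univ_iff.2 (ne_of_mem_erase h))
  rwa [card_fin] at this

theorem coeff_centralPoly_left (a : ℕ) :
    ((centralPoly N).coeff a).coeff N = polyX N ((rootPoly univ).coeff a) := by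
  have h : (rootPoly (univ : Finset (Fin N))).coeff N = 1 := by
    have := coeff_rootPoly_card (univ : Finset (Fin N))
    rwa [card_fin] at this
  rw [coeff_centralPoly_eq_add, h, map_one, mul_one, sum_eq_zero, add_zero]
  intro J hJ
  refine sum_eq_zero fun σ _ => ?_
  rw [coeff_rootPoly_of_lt (card_lt_of_mem_erase_univ hJ), map_zero, mul_zero, zero_mul, smul_zero]

theorem coeff_centralPoly_right (b : ℕ) :
    ((centralPoly N).coeff N).coeff b = polyY N ((rootPoly univ).coeff b) := by
  have h : (rootPoly (univ : Finset (Fin N))).coeff N = 1 := by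
    have := coeff_rootPoly_card (univ : Finset (Fin N))
    rwa [card_fin] at this
  rw [coeff_centralPoly_eq_add, h, map_one, one_mul, sum_eq_zero, add_zero]
  intro J hJ
  refine sum_eq_zero fun σ _ => ?_
  rw [coeff_rootPoly_of_lt (J := J) (b := N) (card_lt_of_mem_erase_univ hJ), map_zero, zero_mul,
    zero_mul, smul_zero]

/-- Only the sets with `N - 1` elements contribute to the symbol. -/
theorem hasSymbol_centralTerm {J : Finset (Fin N)} (hJ : #J < N) {a b d : ℕ}
    (hd : b + d + 1 = N) : HasSymbol d (dunkl N (centralTerm a b J))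
      (if #J + 1 = N then
        -single 1 (inX N ((rootPoly J).coeff a) * inP N ((rootPoly J).coeff b)) else 0) := by
  by_cases hb : #J < b
  · rw [if_neg (by omega), centralTerm, sum_eq_zero, map_zero]
    · exact HasSymbol.zero d
    · intro σ _
      rw [coeff_rootPoly_of_lt hb, map_zero, mul_zero, zero_mul, smul_zero]
  obtain ⟨n, hn⟩ := Nat.exists_eq_add_of_le (not_lt.1 hb)
  have hz := fun (σ : Perm (Fin N)) =>
    (hasSymbol_term hn.symm a σ).zsmul ((-1) ^ N * CherednikSystem.eps J σ)
  simp only [← map_zsmul] at hz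
  split_ifs with hJN
  · obtain ⟨i, rfl⟩ : ∃ i, J = {i}ᶜ := by
      have : #Jᶜ = 1 := by rw [card_compl, Fintype.card_fin]; omega
      obtain ⟨i, hi⟩ := card_eq_one.1 this
      exact ⟨i, by rw [← hi, compl_compl]⟩
    have := hz 1
    rw [neg_one_pow_mul_eps_compl, neg_one_zsmul (single _ _ : SkewXP N)] at this
    rw [centralTerm, fix_compl_singleton, sum_singleton, neg_one_pow_mul_eps_compl]
    obtain rfl : n = d := by omega
    exact this
  · rw [centralTerm, map_sum, ← sum_const_zero (s := CherednikSystem.fix J)]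
    exact HasSymbol.sum fun σ _ => (hz σ).of_lt (by omega)

/-- The algebra generated by the coefficients of the universal central polynomial. -/
noncomputable def coeffAlgebra (N : ℕ) : Subalgebra ℂ (H N) :=
  Algebra.adjoin ℂ (Set.range fun ij : Fin (N + 1) × Fin (N + 1) => c ij.1 ij.2)

theorem coeffAlgebra_le_center : coeffAlgebra N ≤ Subalgebra.center ℂ (H N) := by
  refine Algebra.adjoin_le ?_
  rintro _ ⟨ij, rfl⟩
  exact c_mem_center _ _

theorem coeff_centralPoly_mem {a b : ℕ} (ha : a ≤ N) (hb : b ≤ N) :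
    ((centralPoly N).coeff a).coeff b ∈ coeffAlgebra N := by
  refine Algebra.subset_adjoin ⟨(⟨N - a, by omega⟩, ⟨N - b, by omega⟩), ?_⟩
  simp only [c, Nat.sub_sub_self ha, Nat.sub_sub_self hb]

/-- The rational function `f` is the symbol, in degree `d`, of an element of the algebra generated
by the coefficients of the universal central polynomial. -/
def Lifts (d : ℕ) (f : RatXP N) : Prop :=
  ∃ z ∈ coeffAlgebra N, HasSymbol d (dunkl N z) (single 1 f)

namespace Lifts

variable {d e : ℕ} {f g : RatXP N}

theorem zero (d : ℕ) : Lifts d (0 : RatXP N) :=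
  ⟨0, Subalgebra.zero_mem _, by rw [map_zero, single_zero]; exact HasSymbol.zero d⟩

theorem one : Lifts 0 (1 : RatXP N) :=
  ⟨1, Subalgebra.one_mem _, by rw [map_one]; exact HasSymbol.C 1⟩

theorem sub (hf : Lifts d f) (hg : Lifts d g) : Lifts d (f - g) := by
  obtain ⟨z, hz, hz'⟩ := hf
  obtain ⟨w, hw, hw'⟩ := hg
  refine ⟨z - w, Subalgebra.sub_mem _ hz hw, ?_⟩
  rw [map_sub, sub_eq_add_neg f, single_add, single_neg, ← sub_eq_add_neg]
  exact hz'.sub hw'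

theorem neg (hf : Lifts d f) : Lifts d (-f) := by
  rw [← zero_sub]; exact (zero d).sub hf

theorem add (hf : Lifts d f) (hg : Lifts d g) : Lifts d (f + g) := by
  rw [← sub_neg_eq_add]; exact hf.sub hg.neg

theorem mul (hf : Lifts d f) (hg : Lifts e g) : Lifts (d + e) (f * g) := by
  obtain ⟨z, hz, hz'⟩ := hf
  obtain ⟨w, hw, hw'⟩ := hg
  refine ⟨z * w, Subalgebra.mul_mem _ hz hw, ?_⟩
  have := hz'.mul hw'
  rwa [single_mul_single, one_mul, one_smul, ← map_mul] at this

theorem smul (r : ℂ) (hf : Lifts d f) : Lifts d (r • f) := by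
  obtain ⟨z, hz, hz'⟩ := hf
  refine ⟨r • z, Subalgebra.smul_mem _ hz r, ?_⟩
  rw [map_smul, ← smul_single_one]
  exact hz'.smul r

theorem sum {ι : Type*} {s : Finset ι} {f : ι → RatXP N} (h : ∀ i ∈ s, Lifts d (f i)) :
    Lifts d (∑ i ∈ s, f i) := by
  classical
  induction s using Finset.induction_on with
  | empty => simpa using Lifts.zero d
  | insert i s hi ih =>
    rw [sum_insert hi]
    exact (h i (mem_insert_self _ _)).add (ih fun j hj => h j (mem_insert_of_mem hj))

end Lifts

theorem lifts_elemX (a : ℕ) : Lifts 0 (inX N ((rootPoly univ).coeff a)) := by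
  by_cases ha : a ≤ N
  · exact ⟨_, coeff_centralPoly_mem ha le_rfl, by
      rw [coeff_centralPoly_left]; exact hasSymbol_polyX _⟩
  · rw [coeff_rootPoly_of_lt (by rw [card_fin]; omega), map_zero]
    exact Lifts.zero 0

theorem lifts_elemP {b n : ℕ} (h : b + n = N) : Lifts n (inP N ((rootPoly univ).coeff b)) :=
  ⟨((centralPoly N).coeff N).coeff b, coeff_centralPoly_mem le_rfl (by omega), by
    rw [coeff_centralPoly_right]
    exact hasSymbol_polyY (isHomogeneous_coeff_rootPoly _ _ _ (by rw [card_fin, h]))⟩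

/-- Subtracting the product of the two leading coefficients from a coefficient of the universal
central polynomial exposes the contributions of the sets with `N - 1` elements. -/
theorem lifts_sum_coeff_mul_coeff {a b d : ℕ} (h : b + d + 1 = N) :
    Lifts d (∑ i : Fin N, inX N ((rootPoly {i}ᶜ).coeff a) * inP N ((rootPoly {i}ᶜ).coeff b)) := by
  by_cases ha : N < a
  · refine Lifts.sum fun i _ => ?_
    have : #({i}ᶜ : Finset (Fin N)) < a := by
      rw [card_compl, Fintype.card_fin]; omega
    rw [coeff_rootPoly_of_lt this, map_zero, zero_mul]
    exact Lifts.zero d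
  have h0 : ((centralPoly N).coeff a).coeff N * ((centralPoly N).coeff N).coeff b -
      ((centralPoly N).coeff a).coeff b ∈ coeffAlgebra N :=
    Subalgebra.sub_mem _ (Subalgebra.mul_mem _ (coeff_centralPoly_mem (by omega) le_rfl)
      (coeff_centralPoly_mem le_rfl (by omega))) (coeff_centralPoly_mem (by omega) (by omega))
  rw [coeff_centralPoly_left, coeff_centralPoly_right, coeff_centralPoly_eq_add,
    sub_add_cancel_left] at h0
  refine ⟨_, h0, ?_⟩
  have h1 := (HasSymbol.sum fun J hJ =>
    hasSymbol_centralTerm (a := a) (card_lt_of_mem_erase_univ hJ) h).neg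
  rw [map_neg, map_sum]
  convert h1 using 1
  rw [← sum_filter, sum_neg_distrib, neg_neg, single_sum]
  refine sum_bij (fun i _ => {i}ᶜ) ?_ ?_ ?_ ?_
  · intro i _
    rw [mem_filter, mem_erase, card_compl, Fintype.card_fin, card_singleton]
    refine ⟨⟨fun e => ?_, mem_univ _⟩, by omega⟩
    have := mem_univ i
    rw [← e] at this
    simp at this
  · intro i _ j _ e
    exact singleton_injective (compl_injective e)
  · intro J hJ
    rw [mem_filter] at hJ
    have : #Jᶜ = 1 := by rw [card_compl, Fintype.card_fin]; omega
    obtain ⟨i, hi⟩ := card_eq_one.1 this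
    exact ⟨i, mem_univ _, by rw [← hi, compl_compl]⟩
  · intro i _
    rfl

theorem rootPoly_univ_eq (i : Fin N) :
    rootPoly univ = (X - C (MvPolynomial.X i)) * rootPoly {i}ᶜ := by
  rw [rootPoly, rootPoly, ← Finset.mul_prod_erase _ _ (mem_univ i)]
  congr 2
  ext j
  simp

theorem coeff_rootPoly_compl {i : Fin N} {n : ℕ} (h : n + 1 = N) :
    (rootPoly ({i}ᶜ : Finset (Fin N))).coeff n = 1 := by
  have := coeff_rootPoly_card ({i}ᶜ : Finset (Fin N))
  rwa [card_compl, Fintype.card_fin, card_singleton, ← Nat.eq_sub_of_add_eq h] at this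

theorem X_mul_coeff_rootPoly_succ (i : Fin N) (a : ℕ) :
    MvPolynomial.X i * (rootPoly {i}ᶜ).coeff (a + 1) =
      (rootPoly {i}ᶜ).coeff a - (rootPoly univ).coeff (a + 1) := by
  rw [rootPoly_univ_eq i, coeff_X_sub_C_mul_succ, sub_sub_cancel]

theorem X_mul_coeff_rootPoly_zero (i : Fin N) :
    MvPolynomial.X i * (rootPoly {i}ᶜ).coeff 0 = -(rootPoly univ).coeff 0 := by
  rw [rootPoly_univ_eq i, coeff_X_sub_C_mul_zero, neg_neg]

/-! ### Power sums and invariant polynomials as symbols -/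

theorem lifts_sum_pow_mul_coeff (m : ℕ) : ∀ {a b d : ℕ}, b + d + 1 = N →
    Lifts d (∑ i : Fin N, x i ^ m * inX N ((rootPoly {i}ᶜ).coeff a) *
      inP N ((rootPoly {i}ᶜ).coeff b)) := by
  induction m with
  | zero =>
    intro a b d h
    simpa using lifts_sum_coeff_mul_coeff (a := a) h
  | succ m ih =>
    intro a b d h
    have h1 := (lifts_elemX (N := N) a).mul (ih (a := N - 1) h)
    rw [zero_add] at h1
    have h2 : ∀ i : Fin N, inX N ((rootPoly {i}ᶜ).coeff (N - 1)) = 1 := fun i => by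
      rw [coeff_rootPoly_compl (by omega), map_one]
    cases a with
    | zero =>
      convert h1.neg using 1
      rw [mul_sum, ← sum_neg_distrib]
      refine sum_congr rfl fun i _ => ?_
      have := congrArg (inX N) (X_mul_coeff_rootPoly_zero i)
      rw [map_mul, map_neg, inX_X] at this
      rw [h2]
      linear_combination x i ^ m * inP N ((rootPoly {i}ᶜ).coeff b) * this
    | succ a =>
      convert (ih (a := a) h).sub h1 using 1
      rw [mul_sum, ← sum_sub_distrib]
      refine sum_congr rfl fun i _ => ?_
      have := congrArg (inX N) (X_mul_coeff_rootPoly_succ i a)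
      rw [map_mul, map_sub, inX_X] at this
      rw [h2]
      linear_combination x i ^ m * inP N ((rootPoly {i}ᶜ).coeff b) * this

theorem lifts_sum_pow_mul_pow_mul_coeff (m n : ℕ) : ∀ {b d : ℕ}, b + d + 1 = N →
    Lifts (d + n) (∑ i : Fin N, x i ^ m * p i ^ n * inP N ((rootPoly {i}ᶜ).coeff b)) := by
  induction n with
  | zero =>
    intro b d h
    rw [add_zero]
    convert lifts_sum_pow_mul_coeff m (a := N - 1) h using 1
    refine sum_congr rfl fun i _ => ?_
    rw [coeff_rootPoly_compl (n := N - 1) (by omega), map_one, pow_zero]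
  | succ n ih =>
    intro b d h
    have h2 : ∀ i : Fin N, inP N ((rootPoly {i}ᶜ).coeff (N - 1)) = 1 := fun i => by
      rw [coeff_rootPoly_compl (by omega), map_one]
    have h1 := (lifts_elemP (N := N) (b := b) (n := d + 1) (by omega)).mul
      (ih (b := N - 1) (d := 0) (by omega))
    have hd : d + 1 + (0 + n) = d + (n + 1) := by omega
    rw [hd] at h1
    cases b with
    | zero =>
      convert h1.neg using 1
      rw [mul_sum, ← sum_neg_distrib]
      refine sum_congr rfl fun i _ => ?_
      have := congrArg (inP N) (X_mul_coeff_rootPoly_zero i)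
      rw [map_mul, map_neg, inP_X] at this
      rw [h2]
      linear_combination x i ^ m * p i ^ n * this
    | succ b =>
      have h3 := ih (b := b) (d := d + 1) (by omega)
      have hd' : d + 1 + n = d + (n + 1) := by omega
      rw [hd'] at h3
      convert h3.sub h1 using 1
      rw [mul_sum, ← sum_sub_distrib]
      refine sum_congr rfl fun i _ => ?_
      have := congrArg (inP N) (X_mul_coeff_rootPoly_succ i b)
      rw [map_mul, map_sub, inP_X] at this
      rw [h2]
      linear_combination x i ^ m * p i ^ n * this

/-- The monomial `x_i^a p_i^b`. -/
noncomputable def mono (w : ℕ × ℕ) (i : Fin N) : RatXP N := x i ^ w.1 * p i ^ w.2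

theorem mono_add (v w : ℕ × ℕ) (i : Fin N) : mono (v + w) i = mono v i * mono w i := by
  simp only [mono, Prod.fst_add, Prod.snd_add, pow_add]
  ring

theorem lifts_powerSum (w : ℕ × ℕ) : Lifts w.2 (∑ i : Fin N, mono w i) := by
  rcases Nat.eq_zero_or_pos N with rfl | hN
  · simpa using Lifts.zero _
  have := lifts_sum_pow_mul_pow_mul_coeff (N := N) w.1 w.2 (b := N - 1) (d := 0) (by omega)
  rw [zero_add] at this
  convert this using 1
  refine sum_congr rfl fun i _ => ?_
  rw [coeff_rootPoly_compl (by omega), map_one, mul_one, mono]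

/-- The sum of the products of monomials in different pairs of variables. -/
noncomputable def injSum (N : ℕ) {k : ℕ} (w : Fin k → ℕ × ℕ) : RatXP N :=
  open Classical in
  ∑ e : Fin k → Fin N, if Function.Injective e then ∏ t, mono (w t) (e t) else 0

theorem injSum_succ {k : ℕ} (w : Fin (k + 1) → ℕ × ℕ) :
    injSum N w = (∑ i, mono (w 0) i) * injSum N (fun t => w t.succ) -
      ∑ t, injSum N (Function.update (fun t => w t.succ) t (w t.succ + w 0)) := by
  classical
  simp only [injSum]
  rw [← (Fin.consEquiv fun _ => Fin N).sum_comp, Fintype.sum_prod_type_right]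
  conv_rhs => rw [mul_sum, sum_comm, ← sum_sub_distrib]
  refine sum_congr rfl fun e _ => ?_
  have hinj : ∀ i, Function.Injective (Fin.consEquiv (fun _ => Fin N) (i, e)) ↔
      i ∉ Set.range e ∧ Function.Injective e := fun i => Fin.cons_injective_iff
  simp only [hinj, Fin.consEquiv_apply, Fin.prod_univ_succ, Fin.cons_zero, Fin.cons_succ]
  by_cases he : Function.Injective e
  · have h1 : ∀ t, ∏ s, mono (Function.update (fun t => w t.succ) t (w t.succ + w 0) s) (e s) =
        mono (w 0) (e t) * ∏ s, mono (w s.succ) (e s) := by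
      intro t
      rw [← mul_prod_erase univ _ (mem_univ t), ← mul_prod_erase univ _ (mem_univ t),
        Function.update_self, mono_add]
      rw [prod_congr rfl fun s hs => by rw [Function.update_of_ne (ne_of_mem_erase hs)]]
      ring
    have h2 : ∑ i, mono (w 0) i = ∑ i with i ∉ Set.range e, mono (w 0) i +
        ∑ t, mono (w 0) (e t) := by
      rw [← sum_filter_not_add_sum_filter _ (fun i => i ∈ Set.range e)]
      congr 1
      rw [← sum_image (s := univ) (g := e) (f := mono (w 0)) fun a _ b _ h => he h]
      congr 1
      ext i
      simp
    simp only [he, and_true, if_true, h1]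
    rw [← sum_filter, ← sum_mul, ← sum_mul, h2]
    ring
  · simp [he]

/-- Newton's recursion, in the polarized form, reduces these sums to power sums. -/
theorem lifts_injSum {k : ℕ} : ∀ w : Fin k → ℕ × ℕ, Lifts (∑ t, (w t).2) (injSum N w) := by
  induction k with
  | zero =>
    intro w
    have : injSum N w = 1 := by
      simp [injSum, Function.injective_of_subsingleton]
    rw [this]
    simpa using Lifts.one
  | succ k ih =>
    intro w
    rw [injSum_succ, Fin.sum_univ_succ]
    refine ((lifts_powerSum (w 0)).mul (ih _)).sub (Lifts.sum fun t _ => ?_)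
    convert ih (Function.update (fun t => w t.succ) t (w t.succ + w 0)) using 1
    rw [← add_sum_erase univ _ (mem_univ t), ← add_sum_erase univ _ (mem_univ t),
      Function.update_self, Prod.snd_add]
    rw [sum_congr (g := fun s : Fin k => (w s.succ).2) (s₂ := univ.erase t)
      (f := fun s => (Function.update (fun t : Fin k => w t.succ) t (w t.succ + w 0) s).2) rfl
      fun s hs => by rw [Function.update_of_ne (ne_of_mem_erase hs)]]
    ring

theorem injSum_eq_sum_perm (w : Fin N → ℕ × ℕ) :
    injSum N w = ∑ σ : Perm (Fin N), ∏ t, mono (w t) (σ t) := by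
  classical
  rw [injSum, ← sum_filter]
  refine (sum_bij (fun (σ : Perm (Fin N)) _ => ⇑σ) ?_ ?_ ?_ ?_).symm
  · intro σ _; simpa using σ.injective
  · intro σ _ τ _ h; exact DFunLike.coe_injective h
  · intro e he
    rw [mem_filter] at he
    exact ⟨Equiv.ofBijective e (Finite.injective_iff_bijective.1 he.2), mem_univ _, rfl⟩
  · intro σ _; rfl

theorem smul_ofPoly_monomial (σ : Perm (Fin N)) (m : Fin N ⊕ Fin N →₀ ℕ) :
    σ • ofPoly N (MvPolynomial.monomial m 1) =
      ∏ t, mono (m (Sum.inl t), m (Sum.inr t)) (σ t) := by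
  rw [MvPolynomial.monomial_eq, map_one, one_mul, Finsupp.prod_fintype _ _ fun i => pow_zero _,
    Fintype.prod_sum_type, ← prod_mul_distrib, map_prod, smul_prod']
  refine prod_congr rfl fun t _ => ?_
  rw [map_mul, map_pow, map_pow, smul_mul', smul_pow', smul_pow', mono]
  change (σ • x t) ^ _ * (σ • p t) ^ _ = _
  rw [smul_x, smul_p]

/-- Every invariant polynomial is a combination of symmetrized monomials. -/
theorem lifts_of_invariant {q : XY N} {d : ℕ} (hd : ∀ m ∈ q.support, pDegree m = d)
    (hq : ∀ σ : Perm (Fin N), σ • q = q) : Lifts d (ofPoly N q) := by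
  have h1 : ∑ σ : Perm (Fin N), σ • ofPoly N q = (N.factorial : ℂ) • ofPoly N q := by
    rw [sum_congr rfl fun σ _ => by rw [smul_ofPoly, hq σ], sum_const, card_univ,
      Fintype.card_perm, Fintype.card_fin, Nat.cast_smul_eq_nsmul]
  have h2 : ∑ σ : Perm (Fin N), σ • ofPoly N q = ∑ m ∈ q.support,
      q.coeff m • injSum N (fun t => (m (Sum.inl t), m (Sum.inr t))) := by
    conv_lhs => rw [q.as_sum]
    simp only [injSum_eq_sum_perm, smul_sum, map_sum]
    rw [sum_comm]
    refine sum_congr rfl fun m _ => sum_congr rfl fun σ _ => ?_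
    have e : MvPolynomial.monomial m (q.coeff m) =
        q.coeff m • MvPolynomial.monomial m (1 : ℂ) := by
      rw [MvPolynomial.smul_monomial, smul_eq_mul, mul_one]
    rw [e, map_smul, smul_comm, smul_ofPoly_monomial]
  have h3 : ofPoly N q = (N.factorial : ℂ)⁻¹ • ∑ m ∈ q.support,
      q.coeff m • injSum N (fun t => (m (Sum.inl t), m (Sum.inr t))) := by
    rw [← h2, h1, smul_smul, inv_mul_cancel₀ (Nat.cast_ne_zero.2 N.factorial_ne_zero), one_smul]
  rw [h3]
  refine Lifts.smul _ (Lifts.sum fun m hm => Lifts.smul _ ?_)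
  convert lifts_injSum (N := N) fun t => (m (Sum.inl t), m (Sum.inr t)) using 1
  rw [← hd m hm, pDegree, Finsupp.degree_eq_sum]
  rfl

theorem mem_coeffAlgebra_of_natDegree_le (d : ℕ) : ∀ z ∈ Subalgebra.center ℂ (H N),
    (dunkl N z).natDegree ≤ d → z ∈ coeffAlgebra N := by
  -- subtract an element of the algebra with the same symbol
  have key : ∀ d, ∀ z ∈ Subalgebra.center ℂ (H N), (dunkl N z).natDegree ≤ d →
      ∃ w ∈ coeffAlgebra N, HasSymbol d (dunkl N (z - w)) 0 := by
    intro d z hz hd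
    obtain ⟨q, hq, hinv, hs⟩ := exists_symbol_of_mem_center hz hd
    obtain ⟨w, hw, hw'⟩ := lifts_of_invariant hq hinv
    refine ⟨w, hw, ?_⟩
    have h : HasSymbol d (dunkl N z) (single 1 (ofPoly N q)) := ⟨hd, hs⟩
    rw [map_sub]
    simpa using h.sub hw'
  induction d with
  | zero =>
    intro z hz hd
    obtain ⟨w, hw, hs⟩ := key 0 z hz hd
    have : dunkl N (z - w) = dunkl N 0 := by
      rw [eq_C_of_natDegree_le_zero hs.1, hs.2, map_zero, map_zero]
    rwa [sub_eq_zero.1 (dunkl_injective this)]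
  | succ d ih =>
    intro z hz hd
    obtain ⟨w, hw, hs⟩ := key (d + 1) z hz hd
    have h1 := ih (z - w) (Subalgebra.sub_mem _ hz (coeffAlgebra_le_center hw))
      (natDegree_le_pred hs.1 hs.2)
    have := Subalgebra.add_mem _ h1 hw
    rwa [sub_add_cancel] at this

theorem coeffAlgebra_eq_center : coeffAlgebra N = Subalgebra.center ℂ (H N) :=
  le_antisymm coeffAlgebra_le_center fun z hz => mem_coeffAlgebra_of_natDegree_le _ z hz le_rfl

end

end CherednikTypeA

theorem theorem2p5 (N : ℕ) :
    (∀ i j : Fin (N + 1),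
      CherednikTypeA.c i j ∈ Subalgebra.center ℂ (CherednikTypeA.H N)) ∧
    Algebra.adjoin ℂ
        (Set.range fun ij : Fin (N + 1) × Fin (N + 1) => CherednikTypeA.c ij.1 ij.2) =
      Subalgebra.center ℂ (CherednikTypeA.H N) :=
  ⟨CherednikTypeA.c_mem_center, CherednikTypeA.coeffAlgebra_eq_center⟩
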